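/- Let $n\ge 0$ be an integer, $T>0$, let $H_0,H_1$ be traceless skew-Hermitian complex $n\times n$ matrices, and let $\rho_0,\theta$ be Hermitian $n\times n$ matrices. Put $\mathcal H=L^2([0,T],\mathbb R)$. For $u\in\mathcal H$ let $\rho:[0,T]\to\mathbb C^{n\times n}$ be the (Carathéodory) solution of $$\dot\rho(t)=[H_0+u(t)H_1,\rho(t)],\qquad \rho(0)=\rho_0,$$ and put $\mathrm{End}(u)=\rho(T)$. Let $\mathcal O(\rho_0)=\{U\rho_0U^\dagger: U\in \mathrm{SU}(n)\}$ and $N=\dim\mathcal O(\rho_0)$, that is, the real dimension of the tangent space of $\mathcal O(\rho_0)$ at $\rho_0$. Put $J(\rho)=\mathrm{Re}\,\mathrm{tr}(\rho\theta)$ for $\rho\in\mathcal O(\rho_0)$ and $\mathcal J(u)=J(\mathrm{End}(u))$ for $u\in\mathcal H$. The solution $\rho$ exists and $\rho(T)$ is uniquely determined for every $u \in \mathcal H$, and $\mathrm{End}$ is a $C^\infty$ map from $\mathcal H$ to $\mathbb C^{n\times n}$ with values in $\mathcal O(\rho_0)$; this is part of the claim. Assume (H1) $\rho_0$ and $\theta$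 both have simple eigenvalues; (H2) every control $u\in\mathcal H$ is regular: the rank of the differential $d\mathrm{End}(u)$ equals $N$. Then the function $J$ on $\mathcal O(\rho_0)$ has exactly $n!$ critical points. List them as $\rho_1,\dots,\rho_{n!}$ with $J(\rho_1)\le\dots\le J(\rho_{n!})$, and put $\mathcal H_i=\{u\in\mathcal H:\mathrm{End}(u)=\rho_i\}$. The following hold. (i) The set of critical points of $\mathcal J$ is the disjoint union of the sets $\mathcal H_i$, $i=1,\dots,n!$. (ii) Each $\mathcal H_i$ is a smooth submanifold of $\mathcal H$ of codimension $N$. (iii) For each $i$ and each $u\in\mathcal H_i$, the tangent space $T_u\mathcal H_i$ is $\ker d\mathrm{End}(u)$. -/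

import Mathlib

open MeasureTheory
open scoped ContDiff Matrix

/- Matrices carry the `L²` operator norm. All norms on this finite-dimensional space are
equivalent, so continuity, integrals and derivatives do not depend on the choice. -/
open scoped Matrix.Norms.L2Operator

noncomputable section

namespace QuantumControl

/-! ### Submanifolds of normed spaces -/

section Submanifold

variable {E : Type*} [NormedAddCommGroup E] [NormedSpace ℝ E]

/-- `S` is a smooth (embedded) submanifold of `E` of codimension `N`: around each of its points
there is a smooth diffeomorphism `φ` from an open subset of `E` onto an open subset of a product
`ℝᴺ × K`, where `K` is a closed subspace of `E`, which carries `S` to the slice `{0} × K`. -/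
def IsSubmanifoldOfCodim (N : ℕ) (S : Set E) : Prop :=
  ∀ x ∈ S, ∃ (K : Submodule ℝ E) (φ : OpenPartialHomeomorph E (EuclideanSpace ℝ (Fin N) × K)),
    IsClosed (K : Set E) ∧ x ∈ φ.source ∧
    ContDiffOn ℝ ∞ φ φ.source ∧ ContDiffOn ℝ ∞ φ.symm φ.target ∧
    ∀ y ∈ φ.source, (y ∈ S ↔ (φ y).1 = 0)

/-- The tangent vectors to `S` at `x`: the velocities at time `0` of the smooth curves
`γ : (-ε, ε) → S` with `γ 0 = x`. -/
def tangentVectors (S : Set E) (x : E) : Set E :=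
  {v | ∃ ε > (0 : ℝ), ∃ γ : ℝ → E, ContDiffOn ℝ ∞ γ (Set.Ioo (-ε) ε) ∧
    (∀ t ∈ Set.Ioo (-ε) ε, γ t ∈ S) ∧ γ 0 = x ∧ HasDerivAt γ v 0}

/-- The critical points of the restriction of the function `f` to `S`: the points of `S` at which
the differential of `f` vanishes on the tangent space of `S`. -/
def criticalPointsOn (f : E → ℝ) (S : Set E) : Set E :=
  {x | x ∈ S ∧ DifferentiableAt ℝ f x ∧ ∀ v ∈ tangentVectors S x, fderiv ℝ f x v = 0}

/-- The critical points of a function on the whole space: its Fréchet derivative exists and is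
zero. -/
def criticalPoints (f : E → ℝ) : Set E :=
  {x | HasFDerivAt f (0 : E →L[ℝ] ℝ) x}

end Submanifold

/-! ### The controlled Liouville–von Neumann equation -/

variable {n : ℕ}

/-- The unitary orbit `𝒪(ρ₀) = {U ρ₀ U† : U ∈ SU(n)}`. -/
def unitaryOrbit (ρ₀ : Matrix (Fin n) (Fin n) ℂ) : Set (Matrix (Fin n) (Fin n) ℂ) :=
  {A | ∃ U ∈ Matrix.specialUnitaryGroup (Fin n) ℂ, A = U * ρ₀ * Uᴴ}

/-- The dimension `N` of the orbit `𝒪(ρ₀)`: the real dimension of its tangent space at `ρ₀`. -/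
def orbitDim (ρ₀ : Matrix (Fin n) (Fin n) ℂ) : ℕ :=
  Module.finrank ℝ (Submodule.span ℝ (tangentVectors (unitaryOrbit ρ₀) ρ₀))

/-- The control space `L²([0,T], ℝ)`. -/
abbrev Control (T : ℝ) : Type := Lp ℝ 2 (volume.restrict (Set.Icc (0 : ℝ) T))

/-- `ρ` is the trajectory on `[0,T]` of `ρ' = [H₀ + u(t) H₁, ρ]`, `ρ(0) = ρ₀`, in the
Carathéodory sense: it is continuous and satisfies the integrated equation. -/
def IsTrajectory (H₀ H₁ ρ₀ : Matrix (Fin n) (Fin n) ℂ) (T : ℝ) (u : Control T)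
    (ρ : ℝ → Matrix (Fin n) (Fin n) ℂ) : Prop :=
  ContinuousOn ρ (Set.Icc 0 T) ∧
  ∀ t ∈ Set.Icc (0 : ℝ) T,
    ρ t = ρ₀ + ∫ s in (0 : ℝ)..t, ((H₀ + u s • H₁) * ρ s - ρ s * (H₀ + u s • H₁))

open Classical in
/-- The end-point map `u ↦ ρ(T)`, where `ρ` is the trajectory of the control `u`. -/
def endPoint (H₀ H₁ ρ₀ : Matrix (Fin n) (Fin n) ℂ) (T : ℝ) (u : Control T) :
    Matrix (Fin n) (Fin n) ℂ :=
  if h : ∃ ρ, IsTrajectory H₀ H₁ ρ₀ T u ρ then h.choose T else ρ₀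

/-- The cost `J(ρ) = Re tr(ρ θ)`. -/
def cost (θ ρ : Matrix (Fin n) (Fin n) ℂ) : ℝ := (Matrix.trace (ρ * θ)).re

/-- The cost `𝒥(u) = J(End(u))` on the control space. -/
def controlCost (H₀ H₁ ρ₀ θ : Matrix (Fin n) (Fin n) ℂ) (T : ℝ) (u : Control T) : ℝ :=
  cost θ (endPoint H₀ H₁ ρ₀ T u)

/-- The control `u` is regular: the rank of the differential of the end-point map at `u` is the
dimension of the orbit. -/
def IsRegularControl (H₀ H₁ ρ₀ : Matrix (Fin n) (Fin n) ℂ) (T : ℝ) (u : Control T) : Prop :=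
  Module.finrank ℝ (LinearMap.range (fderiv ℝ (endPoint H₀ H₁ ρ₀ T) u).toLinearMap)
    = orbitDim ρ₀

/-- The fibre `{u : End(u) = σ}` of the end-point map. -/
def fibre (H₀ H₁ ρ₀ : Matrix (Fin n) (Fin n) ℂ) (T : ℝ) (σ : Matrix (Fin n) (Fin n) ℂ) :
    Set (Control T) :=
  {u | endPoint H₀ H₁ ρ₀ T u = σ}

end QuantumControl

end

open QuantumControl

/-! The integrated equation reads `(1 - L_u) ρ = ρ₀` with `L_u` a Volterra operator on `C([0,T])`,
affine and continuous in `u`. Cauchy–Schwarz makes its powers decay factorially, so `1 - L_u` is a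
unit (`isUnit_one_sub_of_volterra`). Since inversion in a Banach algebra is smooth, this gives
existence, uniqueness and smooth dependence on `u` together. For continuous controls `ρ = X ρ₀ X†`
with `X` the unitary propagator; density of such controls and compactness of the orbit put every end
point on the orbit.

Regularity of all controls says that the end-point map has constant rank `N`, so its fibres are
submanifolds with tangent space the kernel of the differential (`exists_slice_chart`). The range of
the differential lies in the span of the tangent vectors to the orbit at the end point; both have
dimension `N`, so they agree, and the chain rule identifies the critical points of `𝒥` with the
preimage of those of `J` (`criticalPoints_controlCost`).

On the orbit, testing `J` on the velocity `[X, ρ]` with `X = [ρ, θ]` gives `-tr(X†X)`, so a critical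
`ρ` commutes with `θ`. As `θ` has simple spectrum, `ρ` is diagonal in its eigenbasis, with the
eigenvalues of `ρ₀` in some order: `n!` candidates. Conversely, `tr ρᵏ` is constant on the orbit, so
a tangent vector `v` at a candidate satisfies `tr(ρᵏ v) = 0` for all `k`. By Vandermonde its
diagonal in the eigenbasis vanishes, hence `tr(v θ) = 0`. No manifold structure on the orbit is
needed, only velocities of curves. -/

namespace QuantumControl

open Topology

/-! ### The constant rank theorem on a Hilbert space -/

section ConstantRank

variable {E F : Type*} [NormedAddCommGroup E] [InnerProductSpace ℝ E] [CompleteSpace E]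
  [NormedAddCommGroup F] [NormedSpace ℝ F] [FiniteDimensional ℝ F]

set_option linter.unusedSectionVars false

/-- A linear map from `F` to `ℝᴺ` which is onto on the range of an operator of rank `N` is
injective on this range. -/
theorem ker_comp_eq_of_surjective {N : ℕ} (A : E →L[ℝ] F)
    (hA : Module.finrank ℝ (LinearMap.range A.toLinearMap) = N)
    (p : F →L[ℝ] EuclideanSpace ℝ (Fin N)) (hp : Function.Surjective (p ∘ A)) {v : E}
    (hv : p (A v) = 0) : A v = 0 := by
  let q : LinearMap.range A.toLinearMap →ₗ[ℝ] EuclideanSpace ℝ (Fin N) :=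
    p.toLinearMap.comp (Submodule.subtype _)
  have hq : Function.Surjective q := fun w => by
    obtain ⟨x, hx⟩ := hp w
    exact ⟨⟨A x, x, rfl⟩, hx⟩
  have hinj : Function.Injective q :=
    (LinearMap.injective_iff_surjective_of_finrank_eq_finrank (by rw [hA]; simp)).2 hq
  have : (⟨A v, v, rfl⟩ : LinearMap.range A.toLinearMap) = 0 := hinj (by rw [map_zero]; exact hv)
  exact congrArg Subtype.val this

/-- An operator of finite rank `N` on a Hilbert space is, up to an injective map on its range, the
first component of an isomorphism onto `ℝᴺ × ker A`. -/
theorem exists_equiv_prod_ker {N : ℕ} (A : E →L[ℝ] F)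
    (hA : Module.finrank ℝ (LinearMap.range A.toLinearMap) = N) :
    ∃ (p : F →L[ℝ] EuclideanSpace ℝ (Fin N)) (P : E →L[ℝ] LinearMap.ker A.toLinearMap)
      (e : E ≃L[ℝ] EuclideanSpace ℝ (Fin N) × LinearMap.ker A.toLinearMap),
      (e : E →L[ℝ] EuclideanSpace ℝ (Fin N) × LinearMap.ker A.toLinearMap)
        = (p.comp A).prod P := by
  have hclosed : IsClosed (LinearMap.ker A.toLinearMap : Set E) := A.isClosed_ker
  have : CompleteSpace (LinearMap.ker A.toLinearMap) := hclosed.completeSpace_coe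
  obtain ⟨r, hr⟩ := Submodule.ClosedComplemented.of_finiteDimensional
    (LinearMap.range A.toLinearMap)
  let i : LinearMap.range A.toLinearMap ≃L[ℝ] EuclideanSpace ℝ (Fin N) :=
    ContinuousLinearEquiv.ofFinrankEq (by rw [hA]; simp)
  let p : F →L[ℝ] EuclideanSpace ℝ (Fin N) := (i : _ →L[ℝ] _).comp r
  let P : E →L[ℝ] LinearMap.ker A.toLinearMap := (LinearMap.ker A.toLinearMap).orthogonalProjectionOnto
  have hP : ∀ k : LinearMap.ker A.toLinearMap, P k = k := fun k =>
    Submodule.orthogonalProjectionOnto_mem_subspace_eq_self k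
  have hpA : ∀ v, p (A v) = i ⟨A v, v, rfl⟩ := fun v => by
    change i (r (A v)) = _
    rw [← hr ⟨A v, v, rfl⟩]
  have hinj : LinearMap.ker ((p.comp A).prod P).toLinearMap = ⊥ := by
    refine LinearMap.ker_eq_bot'.2 fun v hv => ?_
    have h1 : p (A v) = 0 := congrArg Prod.fst hv
    have h2 : P v = 0 := congrArg Prod.snd hv
    rw [hpA, i.map_eq_zero_iff] at h1
    have h3 : A v = 0 := congrArg Subtype.val h1
    have h4 := hP ⟨v, h3⟩
    change P v = _ at h4
    rw [h2] at h4
    exact (congrArg Subtype.val h4).symm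
  have hsurj : LinearMap.range ((p.comp A).prod P).toLinearMap = ⊤ := by
    refine LinearMap.range_eq_top.2 fun ⟨w, k⟩ => ?_
    obtain ⟨v, hv⟩ := (i.symm w).2
    have hAk : ∀ k : LinearMap.ker A.toLinearMap, A k = 0 := fun k => k.2
    -- Replacing the kernel component of `v` by `k` leaves `A v` unchanged.
    refine ⟨v - P v + k, ?_⟩
    have h1 : A (v - P v + k) = A v := by simp [hAk]
    refine Prod.ext ?_ ?_
    · change p (A (v - P v + k)) = w
      rw [h1, hpA, ← i.apply_symm_apply w]
      congr 1
      exact Subtype.ext hv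
    · change P (v - P v + k) = k
      rw [map_add, map_sub, hP, hP]
      simp
  exact ⟨p, P, ContinuousLinearEquiv.ofBijective _ hinj hsurj, rfl⟩

/-- The constant rank theorem: a smooth map of constant rank `N` from a Hilbert space has, around
each point `x`, a chart that carries the fibre through `x` to the slice `{0} × ker`. -/
theorem exists_slice_chart {N : ℕ} {f : E → F} (hf : ContDiff ℝ ∞ f)
    (hN : ∀ x, Module.finrank ℝ (LinearMap.range (fderiv ℝ f x).toLinearMap) = N) (x₀ : E) :
    ∃ (φ : OpenPartialHomeomorph E
        (EuclideanSpace ℝ (Fin N) × LinearMap.ker (fderiv ℝ f x₀).toLinearMap))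
      (e : E ≃L[ℝ] EuclideanSpace ℝ (Fin N) × LinearMap.ker (fderiv ℝ f x₀).toLinearMap),
      x₀ ∈ φ.source ∧ ContDiffOn ℝ ∞ φ φ.source ∧ ContDiffOn ℝ ∞ φ.symm φ.target ∧
      (∀ y ∈ φ.source, (f y = f x₀ ↔ (φ y).1 = 0)) ∧
      HasFDerivAt φ (e : E →L[ℝ] _) x₀ ∧ ∀ v, fderiv ℝ f x₀ v = 0 → (e v).1 = 0 := by
  set K := LinearMap.ker (fderiv ℝ f x₀).toLinearMap with hK
  obtain ⟨p, P, e, he⟩ : ∃ (p : F →L[ℝ] EuclideanSpace ℝ (Fin N)) (P : E →L[ℝ] K)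
      (e : E ≃L[ℝ] EuclideanSpace ℝ (Fin N) × K),
      (e : E →L[ℝ] EuclideanSpace ℝ (Fin N) × K) = (p.comp (fderiv ℝ f x₀)).prod P :=
    exists_equiv_prod_ker (fderiv ℝ f x₀) (hN x₀)
  have hfd : ∀ x, HasFDerivAt f (fderiv ℝ f x) x := fun x =>
    (hf.differentiable (by simp) x).hasFDerivAt
  -- The zero slice of `Φ` only says `p (f x) = p (f x₀)`; constancy of the rank must upgrade this
  -- to `f x = f x₀`.
  let Φ : E → EuclideanSpace ℝ (Fin N) × K := fun x => (p (f x) - p (f x₀), P x)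
  let Φ' : E → E →L[ℝ] EuclideanSpace ℝ (Fin N) × K := fun x => (p.comp (fderiv ℝ f x)).prod P
  have hΦ : ContDiff ℝ ∞ Φ := ((p.contDiff.comp hf).sub contDiff_const).prodMk P.contDiff
  have hΦ' : ∀ x, HasFDerivAt Φ (Φ' x) x := fun x =>
    ((p.hasFDerivAt.comp x (hfd x)).sub_const _).prodMk P.hasFDerivAt
  have hΦ'e : Φ' x₀ = e := he.symm
  have hΦ'c : Continuous Φ' := by
    have : Continuous (fderiv ℝ f) := hf.continuous_fderiv (by simp)
    have h2 : Continuous fun x => p.comp (fderiv ℝ f x) := continuous_const.clm_comp this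
    exact (ContinuousLinearMap.prodₗᵢ (𝕜 := ℝ) (E := E) (F := EuclideanSpace ℝ (Fin N))
      (G := K) ℝ).continuous.comp (h2.prodMk (continuous_const (y := P)))
  have hd0 : HasFDerivAt Φ (e : E →L[ℝ] EuclideanSpace ℝ (Fin N) × K) x₀ := hΦ'e ▸ hΦ' x₀
  let ψ := hΦ.contDiffAt.toOpenPartialHomeomorph Φ hd0 (by simp)
  have hψ : (ψ : E → _) = Φ := rfl
  have hxs : x₀ ∈ ψ.source := hΦ.contDiffAt.mem_toOpenPartialHomeomorph_source hd0 (by simp)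
  have hxt : Φ x₀ ∈ ψ.target := hψ ▸ ψ.map_source hxs
  have hinv : ∀ᶠ y in 𝓝 (Φ x₀), y ∈ ψ.target ∧
      Φ' (ψ.symm y) ∈ Set.range ((↑) : (E ≃L[ℝ] EuclideanSpace ℝ (Fin N) × K) → _) := by
    refine Filter.Eventually.and (ψ.open_target.mem_nhds hxt) ?_
    have h1 : Filter.Tendsto (fun y => Φ' (ψ.symm y)) (𝓝 (Φ x₀))
        (𝓝 (e : E →L[ℝ] EuclideanSpace ℝ (Fin N) × K)) := by
      have h2 : Filter.Tendsto ψ.symm (𝓝 (Φ x₀)) (𝓝 x₀) := by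
        have := (ψ.continuousAt_symm hxt).tendsto
        rwa [← hψ, ψ.left_inv hxs] at this
      exact hΦ'e ▸ (hΦ'c.tendsto x₀).comp h2
    exact h1 (ContinuousLinearEquiv.nhds e)
  obtain ⟨ε, hε, hball⟩ := Metric.eventually_nhds_iff_ball.1 hinv
  set B := Metric.ball (Φ x₀) ε with hB
  have hΦ0 : Φ x₀ = (0, P x₀) := by simp [Φ]
  -- smoothness of the inverse, and its derivative
  have hsymm : ∀ y ∈ B, ContDiffAt ℝ ∞ ψ.symm y := fun y hy => by
    obtain ⟨ht, e', he'⟩ := hball y hy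
    refine ψ.contDiffAt_symm ht (f₀' := e') ?_ hΦ.contDiffAt
    rw [he']; exact hΦ' _
  -- Along the slice direction `p ∘ f` does not move, and since the rank is still `N` at nearby
  -- points, `p` is injective on the range of the differential there. So `f` does not move either.
  have hkill : ∀ y ∈ B, ∀ k : K, fderiv ℝ f (ψ.symm y) (fderiv ℝ ψ.symm y (0, k)) = 0 := by
    intro y hy k
    obtain ⟨ht, e', he'⟩ := hball y hy
    have h1 : HasFDerivAt ψ.symm (e'.symm : _ →L[ℝ] E) y := by
      refine ψ.hasFDerivAt_symm ht ?_
      rw [he']; exact hΦ' _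
    have h3 : ∀ v, p (fderiv ℝ f (ψ.symm y) v) = (e' v).1 := fun v => by
      have := congrArg (fun L : E →L[ℝ] EuclideanSpace ℝ (Fin N) × K => (L v).1) he'
      exact this.symm
    rw [h1.fderiv]
    refine ker_comp_eq_of_surjective _ (hN _) p (fun w => ⟨e'.symm (w, 0), ?_⟩) ?_
    · simp [h3]
    · simp [h3]
  have hconst : ∀ k : K, ((0, k) : EuclideanSpace ℝ (Fin N) × K) ∈ B →
      f (ψ.symm (0, k)) = f x₀ := by
    intro k hk
    let g : K → F := fun k => f (ψ.symm (0, k))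
    have hmem : ∀ k ∈ Metric.ball (P x₀) ε, ((0, k) : EuclideanSpace ℝ (Fin N) × K) ∈ B := by
      intro k hk
      rw [hB, hΦ0, Metric.mem_ball, Prod.dist_eq, dist_self]
      exact max_lt hε hk
    have hk' : k ∈ Metric.ball (P x₀) ε := by
      rw [hB, hΦ0, Metric.mem_ball, Prod.dist_eq] at hk
      exact lt_of_le_of_lt (le_max_right _ _) hk
    have hg : ∀ k ∈ Metric.ball (P x₀) ε, HasFDerivAt g (0 : K →L[ℝ] F) k := by
      intro k hk
      have h1 : HasFDerivAt ψ.symm (fderiv ℝ ψ.symm (0, k)) (0, k) :=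
        ((hsymm _ (hmem k hk)).differentiableAt (by simp)).hasFDerivAt
      have h2 := ((hfd _).comp _ h1).comp k (hasFDerivAt_prodMk_right (𝕜 := ℝ)
        (0 : EuclideanSpace ℝ (Fin N)) k)
      refine h2.congr_fderiv ?_
      ext h
      exact hkill _ (hmem k hk) h
    have h := (convex_ball (P x₀) ε).is_const_of_fderivWithin_eq_zero (𝕜 := ℝ) (f := g)
      (fun k hk => (hg k hk).differentiableAt.differentiableWithinAt)
      (fun k hk => by
        rw [fderivWithin_of_isOpen Metric.isOpen_ball hk, (hg k hk).fderiv])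
      hk' (Metric.mem_ball_self hε)
    change g k = _
    rw [h]
    change f (ψ.symm (0, P x₀)) = _
    rw [← hΦ0, ← hψ, ψ.left_inv hxs]
  -- The ball `B` lives in the target of `ψ`, so the restriction is made on the inverse.
  let φ := (ψ.symm.restrOpen B Metric.isOpen_ball).symm
  have hφs : ∀ y, y ∈ φ.source ↔ y ∈ ψ.source ∧ Φ y ∈ B := fun y => by
    simp only [φ, OpenPartialHomeomorph.symm_source]
    have : Φ y = ψ y := rfl
    rw [this]
    constructor
    · rintro ⟨h1, h2⟩
      exact ⟨h1, by simpa using h2⟩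
    · rintro ⟨h1, h2⟩
      exact ⟨h1, by simpa using h2⟩
  refine ⟨φ, e, (hφs _).2 ⟨hxs, Metric.mem_ball_self hε⟩, hΦ.contDiffOn, ?_, ?_, hd0, ?_⟩
  · intro y hy
    exact (hsymm y hy.2).contDiffWithinAt
  · intro y hy
    obtain ⟨h1, h2⟩ := (hφs y).1 hy
    change _ ↔ p (f y) - p (f x₀) = 0
    refine ⟨fun h => by rw [h, sub_self], fun h => ?_⟩
    have h3 : Φ y = (0, P y) := Prod.ext h rfl
    have := hconst (P y) (h3 ▸ h2)
    rwa [← h3, ← hψ, ψ.left_inv h1] at this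
  · intro v hv
    change ((e : E →L[ℝ] EuclideanSpace ℝ (Fin N) × K) v).1 = 0
    rw [he]
    simp [hv]

theorem isSubmanifoldOfCodim_fibre {N : ℕ} {f : E → F} (hf : ContDiff ℝ ∞ f)
    (hN : ∀ x, Module.finrank ℝ (LinearMap.range (fderiv ℝ f x).toLinearMap) = N) (c : F) :
    IsSubmanifoldOfCodim N {x | f x = c} := by
  rintro x rfl
  obtain ⟨φ, e, h1, h2, h3, h4, -, -⟩ := exists_slice_chart hf hN x
  exact ⟨_, φ, (fderiv ℝ f x).isClosed_ker, h1, h2, h3, h4⟩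

/-- A kernel vector is the velocity of the curve that the slice chart straightens to a line in
direction `e v`, which stays in the slice because `(e v).1 = 0`. -/
theorem tangentVectors_fibre {N : ℕ} {f : E → F} (hf : ContDiff ℝ ∞ f)
    (hN : ∀ x, Module.finrank ℝ (LinearMap.range (fderiv ℝ f x).toLinearMap) = N) (x : E) :
    tangentVectors {y | f y = f x} x = {v | fderiv ℝ f x v = 0} := by
  ext v
  constructor
  · rintro ⟨ε, hε, γ, -, hγ, rfl, hγ'⟩
    have h1 : HasDerivAt (f ∘ γ) (fderiv ℝ f (γ 0) v) 0 :=
      (hf.differentiable (by simp) _).hasFDerivAt.comp_hasDerivAt 0 hγ'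
    have h2 : f ∘ γ =ᶠ[𝓝 0] fun _ => f (γ 0) := by
      filter_upwards [Ioo_mem_nhds (neg_lt_zero.2 hε) hε] with t ht using hγ t ht
    exact h1.unique ((hasDerivAt_const _ _).congr_of_eventuallyEq h2)
  · intro hv
    obtain ⟨φ, e, hx, h2, h3, h4, h5, h6⟩ := exists_slice_chart hf hN x
    have he0 : (e v).1 = 0 := h6 v hv
    have hφ0 : (φ x).1 = 0 := (h4 x hx).1 rfl
    have hev : ∀ᶠ t : ℝ in 𝓝 0, φ x + t • e v ∈ φ.target := by
      have : ContinuousAt (fun t : ℝ => φ x + t • e v) 0 := by fun_prop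
      refine this (φ.open_target.mem_nhds ?_)
      simpa using φ.map_source hx
    obtain ⟨ε, hε, hball⟩ := Metric.eventually_nhds_iff_ball.1 hev
    have hmem : ∀ t ∈ Set.Ioo (-ε) ε, φ x + t • e v ∈ φ.target := fun t ht =>
      hball t (by simpa [Real.ball_eq_Ioo] using ht)
    refine ⟨ε, hε, fun t => φ.symm (φ x + t • e v), ?_, ?_, ?_, ?_⟩
    · exact h3.comp (by fun_prop) hmem
    · intro t ht
      refine (h4 _ (φ.map_target (hmem t ht))).2 ?_
      rw [φ.right_inv (hmem t ht)]
      simp [he0, hφ0]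
    · simp [hx]
    · have h7 : HasFDerivAt φ.symm (e.symm : _ →L[ℝ] E) (φ x + (0 : ℝ) • e v) := by
        rw [zero_smul, add_zero]
        refine φ.hasFDerivAt_symm (φ.map_source hx) ?_
        rwa [φ.left_inv hx]
      have h8 : HasDerivAt (fun t : ℝ => φ x + t • e v) (e v) 0 := by
        simpa using ((hasDerivAt_id (0 : ℝ)).smul_const (e v)).const_add (φ x)
      simpa [Function.comp_def] using h7.comp_hasDerivAt (0 : ℝ) h8

end ConstantRank

/-! ### Volterra operators with square-integrable controls, and the flow of a linear system -/

section Volterra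

/-- The Cauchy–Schwarz inequality for integrals, in squared form. -/
theorem sq_integral_mul_norm_le {α V : Type*} [MeasurableSpace α] {μ : Measure α}
    [NormedAddCommGroup V] {a : α → ℝ} {b : α → V} (ha : MemLp a 2 μ) (hb : MemLp b 2 μ) :
    (∫ s, |a s| * ‖b s‖ ∂μ) ^ 2 ≤ (∫ s, a s ^ 2 ∂μ) * ∫ s, ‖b s‖ ^ 2 ∂μ := by
  have h := integral_mul_le_Lp_mul_Lq_of_nonneg (μ := μ) Real.HolderConjugate.two_two
    (f := fun s => |a s|) (g := fun s => ‖b s‖) (.of_forall fun s => abs_nonneg _)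
    (.of_forall fun s => norm_nonneg _) (by rw [ENNReal.ofReal_ofNat]; exact ha.abs)
    (by rw [ENNReal.ofReal_ofNat]; exact hb.norm)
  simp only [Real.rpow_two, sq_abs, ← Real.sqrt_eq_rpow] at h
  calc _ ≤ _ := pow_le_pow_left₀ (integral_nonneg fun s => by positivity) h 2
    _ = _ := by
      rw [mul_pow, Real.sq_sqrt (integral_nonneg fun s => by positivity),
        Real.sq_sqrt (integral_nonneg fun s => by positivity)]

variable {T : ℝ} {V : Type*} [NormedAddCommGroup V] [NormedSpace ℝ V]

theorem norm_sq_eq_integral (u : Control T) :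
    ‖u‖ ^ 2 = ∫ s in Set.Icc 0 T, u s ^ 2 := by
  have := L2.inner_def (𝕜 := ℝ) u u
  rw [real_inner_self_eq_norm_sq] at this
  simpa [sq] using this

theorem integrable_sq (u : Control T) :
    IntegrableOn (fun s => u s ^ 2) (Set.Icc 0 T) :=
  (Lp.memLp u).integrable_sq

theorem integrableOn_control_smul (u : Control T) {g : ℝ → V} (hg : ContinuousOn g (Set.Icc 0 T)) :
    IntegrableOn (fun s => u s • g s) (Set.Icc 0 T) :=
  IntegrableOn.smul_continuousOn ((Lp.memLp u).integrable (by norm_num)) hg isCompact_Icc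

/-- Squaring separates the `L²` control from an integral over `[0,t]` of `‖g‖²`, a form that can be
iterated. -/
theorem norm_sq_integral_control_smul_le (u : Control T) {g : ℝ → V}
    (hg : ContinuousOn g (Set.Icc 0 T)) {t : ℝ} (ht : t ∈ Set.Icc 0 T) :
    ‖∫ s in (0 : ℝ)..t, u s • g s‖ ^ 2 ≤ ‖u‖ ^ 2 * ∫ s in (0 : ℝ)..t, ‖g s‖ ^ 2 := by
  have hsub : Set.Ioc 0 t ⊆ Set.Icc 0 T := fun s hs => ⟨hs.1.le, hs.2.trans ht.2⟩
  have hle : volume.restrict (Set.Ioc 0 t) ≤ volume.restrict (Set.Icc 0 T) :=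
    Measure.restrict_mono hsub le_rfl
  have hg2 : MemLp g 2 (volume.restrict (Set.Ioc 0 t)) := by
    have h1 : AEStronglyMeasurable g (volume.restrict (Set.Icc 0 T)) :=
      hg.aestronglyMeasurable measurableSet_Icc
    have h2 : MemLp g 2 (volume.restrict (Set.Icc 0 T)) :=
      (memLp_two_iff_integrable_sq_norm h1).2
        ((hg.norm.pow 2).integrableOn_compact isCompact_Icc)
    exact h2.mono_measure hle
  have hu2 : MemLp u 2 (volume.restrict (Set.Ioc 0 t)) := (Lp.memLp u).mono_measure hle
  rw [intervalIntegral.integral_of_le ht.1, intervalIntegral.integral_of_le ht.1]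
  calc ‖∫ s in Set.Ioc 0 t, u s • g s‖ ^ 2 ≤ (∫ s in Set.Ioc 0 t, |u s| * ‖g s‖) ^ 2 := by
        refine pow_le_pow_left₀ (norm_nonneg _) ((norm_integral_le_integral_norm _).trans_eq ?_) 2
        simp [norm_smul]
    _ ≤ (∫ s in Set.Ioc 0 t, u s ^ 2) * ∫ s in Set.Ioc 0 t, ‖g s‖ ^ 2 :=
        sq_integral_mul_norm_le hu2 hg2
    _ ≤ _ := by
        refine mul_le_mul_of_nonneg_right ?_ (integral_nonneg fun s => by positivity)
        rw [norm_sq_eq_integral]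
        exact setIntegral_mono_set (integrable_sq u) (.of_forall fun s => sq_nonneg _)
          hsub.eventuallyLE

theorem intervalIntegrable_control_smul (u : Control T) {g : ℝ → V}
    (hg : ContinuousOn g (Set.Icc 0 T)) {t : ℝ} (ht : t ∈ Set.Icc 0 T) :
    IntervalIntegrable (fun s => u s • g s) volume 0 t := by
  rw [intervalIntegrable_iff_integrableOn_Icc_of_le ht.1]
  exact (integrableOn_control_smul u hg).mono_set (Set.Icc_subset_Icc_right ht.2)

theorem intervalIntegral_congr_control {f g : ℝ → V} {t : ℝ} (ht : t ∈ Set.Icc 0 T)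
    (h : ∀ᵐ s ∂(volume.restrict (Set.Icc 0 T)), f s = g s) :
    ∫ s in (0 : ℝ)..t, f s = ∫ s in (0 : ℝ)..t, g s := by
  refine intervalIntegral.integral_congr_ae ?_
  rw [ae_restrict_iff' measurableSet_Icc] at h
  filter_upwards [h] with s hs hst
  rw [Set.uIoc_of_le ht.1] at hst
  exact hs ⟨hst.1.le, hst.2.trans ht.2⟩

/-- The function `t ↦ ∫₀ᵗ u(s) f(s) ds`. -/
noncomputable def controlPrimitive (hT : 0 ≤ T) (u : Control T) (f : C(Set.Icc (0 : ℝ) T, V)) :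
    C(Set.Icc (0 : ℝ) T, V) where
  toFun t := ∫ s in (0 : ℝ)..t, u s • Set.IccExtend hT f s
  continuous_toFun := by
    have h := intervalIntegral.continuousOn_primitive_interval (a := 0) (b := T)
      (μ := volume) (f := fun s => u s • Set.IccExtend hT f s) (by
        rw [Set.uIcc_of_le hT]
        exact integrableOn_control_smul u f.continuous.Icc_extend'.continuousOn)
    rw [Set.uIcc_of_le hT] at h
    exact continuousOn_iff_continuous_domRestrict.1 h

theorem controlPrimitive_apply (hT : 0 ≤ T) (u : Control T) (f : C(Set.Icc (0 : ℝ) T, V))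
    (t : Set.Icc (0 : ℝ) T) :
    controlPrimitive hT u f t = ∫ s in (0 : ℝ)..t, u s • Set.IccExtend hT f s := rfl

theorem norm_sq_controlPrimitive_apply_le (hT : 0 ≤ T) (u : Control T)
    (f : C(Set.Icc (0 : ℝ) T, V)) (t : Set.Icc (0 : ℝ) T) :
    ‖controlPrimitive hT u f t‖ ^ 2
      ≤ ‖u‖ ^ 2 * ∫ s in (0 : ℝ)..t, ‖Set.IccExtend hT f s‖ ^ 2 :=
  norm_sq_integral_control_smul_le u f.continuous.Icc_extend'.continuousOn t.2

/-- The Volterra operator `f ↦ (t ↦ ∫₀ᵗ u(s) f(s) ds)`, linear in `u` and in `f`. -/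
noncomputable def controlPrimitiveL (V : Type*) [NormedAddCommGroup V] [NormedSpace ℝ V]
    (hT : 0 ≤ T) :
    Control T →L[ℝ] C(Set.Icc (0 : ℝ) T, V) →L[ℝ] C(Set.Icc (0 : ℝ) T, V) :=
  LinearMap.mkContinuous₂
    (LinearMap.mk₂ ℝ (controlPrimitive hT)
      (by
        intro u v f
        ext t
        have hf := f.continuous.Icc_extend' (h := hT) |>.continuousOn (s := Set.Icc 0 T)
        simp only [ContinuousMap.add_apply, controlPrimitive_apply]
        rw [← intervalIntegral.integral_add (intervalIntegrable_control_smul u hf t.2)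
          (intervalIntegrable_control_smul v hf t.2)]
        refine intervalIntegral_congr_control t.2 ?_
        filter_upwards [Lp.coeFn_add u v] with s hs
        rw [hs, Pi.add_apply, add_smul])
      (by
        intro c u f
        ext t
        simp only [ContinuousMap.smul_apply, controlPrimitive_apply]
        rw [← intervalIntegral.integral_smul]
        refine intervalIntegral_congr_control t.2 ?_
        filter_upwards [Lp.coeFn_smul c u] with s hs
        rw [hs, Pi.smul_apply, smul_assoc])
      (by
        intro u f g
        ext t
        simp only [ContinuousMap.add_apply, controlPrimitive_apply]
        rw [← intervalIntegral.integral_add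
          (intervalIntegrable_control_smul u f.continuous.Icc_extend'.continuousOn t.2)
          (intervalIntegrable_control_smul u g.continuous.Icc_extend'.continuousOn t.2)]
        simp [Set.IccExtend])
      (by
        intro c u f
        ext t
        simp only [ContinuousMap.smul_apply, controlPrimitive_apply]
        rw [← intervalIntegral.integral_smul]
        simp [Set.IccExtend, smul_comm c]))
    -- Cauchy–Schwarz bounds the primitive by `‖u‖` times the `L²` norm of `f`, which is at most `√T
    -- ‖f‖`.
    (Real.sqrt T)
    (by
      intro u f
      refine (ContinuousMap.norm_le _ (by positivity)).2 fun t => ?_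
      refine abs_le_of_sq_le_sq' ?_ (by positivity) |>.2
      refine (norm_sq_controlPrimitive_apply_le hT u f t).trans ?_
      have h1 : ∫ s in (0 : ℝ)..t, ‖Set.IccExtend hT f s‖ ^ 2 ≤ ∫ s in (0 : ℝ)..t, ‖f‖ ^ 2 := by
        refine intervalIntegral.integral_mono_on t.2.1
          (Continuous.intervalIntegrable (by fun_prop) _ _)
          (Continuous.intervalIntegrable (by fun_prop) _ _) fun s _ => ?_
        exact pow_le_pow_left₀ (norm_nonneg _) (f.norm_coe_le_norm _) 2
      rw [intervalIntegral.integral_const, sub_zero, smul_eq_mul] at h1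
      have h2 : (t : ℝ) * ‖f‖ ^ 2 ≤ T * ‖f‖ ^ 2 :=
        mul_le_mul_of_nonneg_right t.2.2 (by positivity)
      calc _ ≤ ‖u‖ ^ 2 * (T * ‖f‖ ^ 2) := mul_le_mul_of_nonneg_left (h1.trans h2) (by positivity)
        _ = _ := by rw [mul_pow, mul_pow, Real.sq_sqrt hT]; ring)

theorem norm_sq_controlPrimitiveL_apply_le (hT : 0 ≤ T) (u : Control T)
    (f : C(Set.Icc (0 : ℝ) T, V)) (t : Set.Icc (0 : ℝ) T) :
    ‖controlPrimitiveL V hT u f t‖ ^ 2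
      ≤ ‖u‖ ^ 2 * ∫ s in (0 : ℝ)..t, ‖Set.IccExtend hT f s‖ ^ 2 :=
  norm_sq_controlPrimitive_apply_le hT u f t

/-- A Volterra operator `L` is quasi-nilpotent, so `1 - L` is invertible. -/
theorem isUnit_one_sub_of_volterra [CompleteSpace V] (hT : 0 ≤ T)
    (L : C(Set.Icc (0 : ℝ) T, V) →L[ℝ] C(Set.Icc (0 : ℝ) T, V)) {C : ℝ} (hC : 0 ≤ C)
    (hL : ∀ f (t : Set.Icc (0 : ℝ) T),
      ‖L f t‖ ^ 2 ≤ C * ∫ s in (0 : ℝ)..t, ‖Set.IccExtend hT f s‖ ^ 2) :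
    IsUnit (1 - L) := by
  -- Each application integrates `sᵏ` to `tᵏ⁺¹/(k+1)`, which builds up the factorial.
  have hpow : ∀ (k : ℕ) f (t : Set.Icc (0 : ℝ) T),
      ‖(L ^ k) f t‖ ^ 2 ≤ (C * t) ^ k / k.factorial * ‖f‖ ^ 2 := by
    intro k
    induction k with
    | zero =>
      intro f t
      simpa using pow_le_pow_left₀ (norm_nonneg _) (f.norm_coe_le_norm t) 2
    | succ k ih =>
      intro f t
      rw [pow_succ' L, mul_apply_eq_comp]
      refine (hL _ t).trans ?_
      have h1 : ∫ s in (0 : ℝ)..t, ‖Set.IccExtend hT ((L ^ k) f) s‖ ^ 2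
          ≤ ∫ s in (0 : ℝ)..t, (C * s) ^ k / k.factorial * ‖f‖ ^ 2 := by
        refine intervalIntegral.integral_mono_on t.2.1
          (Continuous.intervalIntegrable (by fun_prop) _ _)
          (Continuous.intervalIntegrable (by fun_prop) _ _) fun s hs => ?_
        have hs' : s ∈ Set.Icc 0 T := ⟨hs.1, hs.2.trans t.2.2⟩
        rw [Set.IccExtend_of_mem _ _ hs']
        exact ih f ⟨s, hs'⟩
      refine (mul_le_mul_of_nonneg_left h1 hC).trans_eq ?_
      have h2 : ∀ s : ℝ, (C * s) ^ k / k.factorial * ‖f‖ ^ 2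
          = (C ^ k / k.factorial * ‖f‖ ^ 2) * s ^ k := fun s => by rw [mul_pow]; ring
      simp only [h2]
      rw [intervalIntegral.integral_const_mul, integral_pow, Nat.factorial_succ]
      push_cast
      field_simp
      ring
  -- The estimate is on squared norms, so `1/4` yields `‖Lᵏ‖ ≤ 1/2`.
  obtain ⟨k, hk⟩ : ∃ k : ℕ, (C * T) ^ k / k.factorial < 1 / 4 :=
    ((FloorSemiring.tendsto_pow_div_factorial_atTop (C * T)).eventually
      (gt_mem_nhds (by norm_num))).exists
  have hnorm : ‖L ^ k‖ < 1 := by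
    refine lt_of_le_of_lt (ContinuousLinearMap.opNorm_le_bound _ (M := 1 / 2) (by norm_num)
      fun f => ?_) (by norm_num)
    refine (ContinuousMap.norm_le _ (by positivity)).2 fun t => ?_
    refine abs_le_of_sq_le_sq' ?_ (by positivity) |>.2
    refine (hpow k f t).trans ?_
    have : (C * t) ^ k / k.factorial ≤ (C * T) ^ k / k.factorial := by
      have := t.2.1
      have := t.2.2
      gcongr
    calc _ ≤ (1 / 4) * ‖f‖ ^ 2 := by
          refine mul_le_mul_of_nonneg_right (this.trans hk.le) (by positivity)
      _ = _ := by ring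
  have h : IsUnit (1 - L ^ k) :=
    isUnit_one_sub_of_norm_lt_one (R := C(Set.Icc (0 : ℝ) T, V) →L[ℝ] C(Set.Icc (0 : ℝ) T, V)) hnorm
  -- `1 - Lᵏ` is a product of `1 - L` and a geometric sum; the factors commute, so each is a unit.
  rw [← mul_neg_geom_sum L k] at h
  refine ((Commute.isUnit_mul_iff ?_).1 h).1
  exact (Commute.sub_left (Commute.one_left _)
    (Commute.sum_right _ _ _ fun i _ => (Commute.refl L).pow_right i))

/-- The integral operator of the linear control system `ẋ = (A₀ + u A₁) x`. -/
noncomputable def systemOperator (hT : 0 ≤ T) (A₀ A₁ : V →L[ℝ] V) (u : Control T) :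
    C(Set.Icc (0 : ℝ) T, V) →L[ℝ] C(Set.Icc (0 : ℝ) T, V) :=
  (controlPrimitiveL V hT (Lp.const 2 (volume.restrict (Set.Icc (0 : ℝ) T)) (1 : ℝ))).comp
      (A₀.compLeftContinuous ℝ _) +
    (controlPrimitiveL V hT u).comp (A₁.compLeftContinuous ℝ _)

theorem systemOperator_apply (hT : 0 ≤ T) (A₀ A₁ : V →L[ℝ] V) (u : Control T)
    (f : C(Set.Icc (0 : ℝ) T, V)) (t : Set.Icc (0 : ℝ) T) :
    systemOperator hT A₀ A₁ u f t
      = ∫ s in (0 : ℝ)..t, (A₀ (Set.IccExtend hT f s) + u s • A₁ (Set.IccExtend hT f s)) := by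
  have hc : ∀ A : V →L[ℝ] V, ContinuousOn (fun s => A (Set.IccExtend hT f s)) (Set.Icc 0 T) :=
    fun A => (A.continuous.comp f.continuous.Icc_extend').continuousOn
  change (∫ s in (0 : ℝ)..t, Lp.const 2 (volume.restrict (Set.Icc (0 : ℝ) T)) (1 : ℝ) s •
    A₀ (Set.IccExtend hT f s)) + (∫ s in (0 : ℝ)..t, u s • A₁ (Set.IccExtend hT f s)) = _
  rw [← intervalIntegral.integral_add (intervalIntegrable_control_smul _ (hc A₀) t.2)
    (intervalIntegrable_control_smul u (hc A₁) t.2)]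
  refine intervalIntegral_congr_control t.2 ?_
  filter_upwards [Lp.coeFn_const (p := 2) (μ := volume.restrict (Set.Icc (0 : ℝ) T)) (1 : ℝ)]
    with s hs
  rw [hs, Function.const_apply, one_smul]

theorem contDiff_systemOperator (hT : 0 ≤ T) (A₀ A₁ : V →L[ℝ] V) :
    ContDiff ℝ ∞ (systemOperator hT A₀ A₁) :=
  contDiff_const.add ((controlPrimitiveL V hT).contDiff.clm_comp contDiff_const)

theorem isUnit_one_sub_systemOperator [CompleteSpace V] (hT : 0 ≤ T) (A₀ A₁ : V →L[ℝ] V)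
    (u : Control T) : IsUnit (1 - systemOperator hT A₀ A₁ u) := by
  have hcomp : ∀ (v : Control T) (A : V →L[ℝ] V) (f : C(Set.Icc (0 : ℝ) T, V))
      (t : Set.Icc (0 : ℝ) T),
      ‖controlPrimitiveL V hT v (A.compLeftContinuous ℝ _ f) t‖ ^ 2
        ≤ (‖v‖ ^ 2 * ‖A‖ ^ 2) * ∫ s in (0 : ℝ)..t, ‖Set.IccExtend hT f s‖ ^ 2 := by
    intro v A f t
    refine (norm_sq_controlPrimitiveL_apply_le hT v _ t).trans ?_
    rw [mul_assoc]
    refine mul_le_mul_of_nonneg_left ?_ (sq_nonneg ‖v‖)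
    rw [← intervalIntegral.integral_const_mul]
    refine intervalIntegral.integral_mono_on t.2.1
      (Continuous.intervalIntegrable (by fun_prop) _ _)
      (Continuous.intervalIntegrable (by fun_prop) _ _) fun s _ => ?_
    rw [← mul_pow]
    exact pow_le_pow_left₀ (norm_nonneg _) (A.le_opNorm _) 2
  set e := Lp.const 2 (volume.restrict (Set.Icc (0 : ℝ) T)) (1 : ℝ)
  -- The drift is the Volterra operator of the constant control `e`; the factor `2` comes from `(a +
  -- b)² ≤ 2(a² + b²)`.
  refine isUnit_one_sub_of_volterra hT _
    (C := 2 * (‖e‖ ^ 2 * ‖A₀‖ ^ 2 + ‖u‖ ^ 2 * ‖A₁‖ ^ 2)) (by positivity) fun f t => ?_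
  have h0 := hcomp e A₀ f t
  have h1 := hcomp u A₁ f t
  calc _ ≤ (‖controlPrimitiveL V hT e (A₀.compLeftContinuous ℝ _ f) t‖
        + ‖controlPrimitiveL V hT u (A₁.compLeftContinuous ℝ _ f) t‖) ^ 2 :=
        pow_le_pow_left₀ (norm_nonneg _) (norm_add_le _ _) 2
    _ ≤ 2 * (‖controlPrimitiveL V hT e (A₀.compLeftContinuous ℝ _ f) t‖ ^ 2
        + ‖controlPrimitiveL V hT u (A₁.compLeftContinuous ℝ _ f) t‖ ^ 2) := add_sq_le
    _ ≤ _ := by linarith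

/-- The solution of `ẋ = (A₀ + u A₁) x`, `x(0) = v`, as a continuous function on `[0,T]`. -/
noncomputable def flow (hT : 0 ≤ T) (A₀ A₁ : V →L[ℝ] V) (v : V) (u : Control T) :
    C(Set.Icc (0 : ℝ) T, V) :=
  Ring.inverse (1 - systemOperator hT A₀ A₁ u) (ContinuousMap.const _ v)

/-- Inversion is smooth at units, and the operator inverted is a unit depending smoothly on `u`. -/
theorem contDiff_flow [CompleteSpace V] (hT : 0 ≤ T) (A₀ A₁ : V →L[ℝ] V) (v : V) :
    ContDiff ℝ ∞ (flow hT A₀ A₁ v) := by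
  refine ContDiff.clm_apply (contDiff_iff_contDiffAt.2 fun u => ?_) contDiff_const
  obtain ⟨U, hU⟩ := isUnit_one_sub_systemOperator hT A₀ A₁ u
  have h := contDiffAt_ringInverse (R := C(Set.Icc (0 : ℝ) T, V) →L[ℝ] C(Set.Icc (0 : ℝ) T, V)) ℝ
    (n := ∞) U
  rw [hU] at h
  exact h.comp u (contDiff_const.sub (contDiff_systemOperator hT A₀ A₁)).contDiffAt

theorem eq_flow_iff [CompleteSpace V] (hT : 0 ≤ T) (A₀ A₁ : V →L[ℝ] V) (v : V) (u : Control T)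
    (f : C(Set.Icc (0 : ℝ) T, V)) :
    f = flow hT A₀ A₁ v u ↔ ∀ t : Set.Icc (0 : ℝ) T, f t = v +
      ∫ s in (0 : ℝ)..t, (A₀ (Set.IccExtend hT f s) + u s • A₁ (Set.IccExtend hT f s)) := by
  have hu := isUnit_one_sub_systemOperator hT A₀ A₁ u
  have h1 : f = flow hT A₀ A₁ v u ↔
      (1 - systemOperator hT A₀ A₁ u) f = ContinuousMap.const _ v := by
    constructor
    · rintro rfl
      rw [flow, ← mul_apply_eq_comp, Ring.mul_inverse_cancel _ hu]
      rfl
    · intro h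
      rw [flow, ← h, ← mul_apply_eq_comp, Ring.inverse_mul_cancel _ hu]
      rfl
  rw [h1, ContinuousMap.ext_iff]
  refine forall_congr' fun t => ?_
  rw [← systemOperator_apply]
  exact sub_eq_iff_eq_add

/-- A function is a Carathéodory solution on `[0,T]` if and only if it agrees there with the
flow. -/
theorem caratheodory_iff [CompleteSpace V] (hT : 0 ≤ T) (A₀ A₁ : V →L[ℝ] V) (v : V)
    (u : Control T) (x : ℝ → V) :
    (ContinuousOn x (Set.Icc 0 T) ∧ ∀ t ∈ Set.Icc (0 : ℝ) T,
      x t = v + ∫ s in (0 : ℝ)..t, (A₀ (x s) + u s • A₁ (x s))) ↔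
    ∀ t : Set.Icc (0 : ℝ) T, x t = flow hT A₀ A₁ v u t := by
  have key : ∀ f : C(Set.Icc (0 : ℝ) T, V), (∀ t : Set.Icc (0 : ℝ) T, x t = f t) →
      ∀ t : Set.Icc (0 : ℝ) T, ∫ s in (0 : ℝ)..t, (A₀ (x s) + u s • A₁ (x s)) =
        ∫ s in (0 : ℝ)..t, (A₀ (Set.IccExtend hT f s) + u s • A₁ (Set.IccExtend hT f s)) := by
    intro f hf t
    refine intervalIntegral.integral_congr fun s hs => ?_
    rw [Set.uIcc_of_le t.2.1] at hs
    have hs' : s ∈ Set.Icc 0 T := ⟨hs.1, hs.2.trans t.2.2⟩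
    have h2 : x s = Set.IccExtend hT f s := by
      rw [Set.IccExtend_of_mem _ _ hs']
      exact hf ⟨s, hs'⟩
    simp only [h2]
  constructor
  · rintro ⟨hx, h⟩
    let f : C(Set.Icc (0 : ℝ) T, V) := ⟨_, continuousOn_iff_continuous_domRestrict.1 hx⟩
    have hf : f = flow hT A₀ A₁ v u := by
      refine (eq_flow_iff hT A₀ A₁ v u f).2 fun t => ?_
      rw [← key f (fun _ => rfl) t]
      exact h t t.2
    exact fun t => DFunLike.congr_fun hf t
  · intro h
    have h2 := (eq_flow_iff hT A₀ A₁ v u _).1 rfl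
    refine ⟨?_, fun t ht => ?_⟩
    · refine continuousOn_iff_continuous_domRestrict.2 ?_
      have : (Set.Icc 0 T).domRestrict x = flow hT A₀ A₁ v u := funext h
      rw [this]
      exact (flow hT A₀ A₁ v u).continuous
    · rw [key _ h ⟨t, ht⟩, ← h2 ⟨t, ht⟩]
      exact h ⟨t, ht⟩

end Volterra

/-! ### Classical solutions for continuous controls, and their density -/

section ContinuousControl

variable {T : ℝ} {V : Type*} [NormedAddCommGroup V] [NormedSpace ℝ V] [CompleteSpace V]

/-- For a control with a continuous representative the flow is a classical solution. -/
theorem exists_hasDerivAt_flow (hT : 0 ≤ T) (A₀ A₁ : V →L[ℝ] V) (v : V) (u : Control T)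
    {c : ℝ → ℝ} (hc : Continuous c) (hu : ∀ᵐ s ∂(volume.restrict (Set.Icc 0 T)), u s = c s) :
    ∃ x : ℝ → V, x 0 = v ∧ (∀ t ∈ Set.Icc 0 T, HasDerivAt x (A₀ (x t) + c t • A₁ (x t)) t) ∧
      ∀ t : Set.Icc (0 : ℝ) T, x t = flow hT A₀ A₁ v u t := by
  set f := flow hT A₀ A₁ v u with hf
  set g := Set.IccExtend hT f with hg
  have hgc : Continuous g := f.continuous.Icc_extend'
  have hG : Continuous fun s => A₀ (g s) + c s • A₁ (g s) := by fun_prop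
  -- The integrand is extended beyond `[0,T]` so that `x` has two-sided derivatives at the end
  -- points too.
  let x : ℝ → V := fun t => v + ∫ s in (0 : ℝ)..t, (A₀ (g s) + c s • A₁ (g s))
  have hx : ∀ t : Set.Icc (0 : ℝ) T, x t = f t := fun t => by
    rw [(eq_flow_iff hT A₀ A₁ v u f).1 hf t]
    refine congrArg (v + ·) (intervalIntegral_congr_control t.2 ?_)
    filter_upwards [hu] with s hs
    rw [hs]
  refine ⟨x, by simp [x], fun t ht => ?_, hx⟩
  have h1 : x t = g t := by rw [hg, Set.IccExtend_of_mem _ _ ht]; exact hx ⟨t, ht⟩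
  rw [h1]
  exact (intervalIntegral.integral_hasDerivAt_right (hG.intervalIntegrable _ _)
    hG.aestronglyMeasurable.stronglyMeasurableAtFilter hG.continuousAt).const_add v

theorem eq_flow_of_hasDerivAt (hT : 0 ≤ T) (A₀ A₁ : V →L[ℝ] V) (v : V) (u : Control T)
    {c : ℝ → ℝ} (hc : Continuous c) (hu : ∀ᵐ s ∂(volume.restrict (Set.Icc 0 T)), u s = c s)
    {x : ℝ → V} (hx0 : x 0 = v)
    (hx : ∀ t ∈ Set.Icc 0 T, HasDerivAt x (A₀ (x t) + c t • A₁ (x t)) t)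
    (t : Set.Icc (0 : ℝ) T) : x t = flow hT A₀ A₁ v u t := by
  have hxc : ContinuousOn x (Set.Icc 0 T) := fun t ht => (hx t ht).continuousAt.continuousWithinAt
  refine (caratheodory_iff hT A₀ A₁ v u x).1 ⟨hxc, fun t ht => ?_⟩ t
  have h1 : ∫ s in (0 : ℝ)..t, (A₀ (x s) + u s • A₁ (x s))
      = ∫ s in (0 : ℝ)..t, (A₀ (x s) + c s • A₁ (x s)) := by
    refine intervalIntegral_congr_control ht ?_
    filter_upwards [hu] with s hs
    rw [hs]
  have hsub : Set.uIcc 0 t ⊆ Set.Icc 0 T := by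
    rw [Set.uIcc_of_le ht.1]
    exact Set.Icc_subset_Icc_right ht.2
  have hI : ContinuousOn (fun s => A₀ (x s) + c s • A₁ (x s)) (Set.uIcc 0 t) := by
    have := hxc.mono hsub
    fun_prop
  rw [h1, intervalIntegral.integral_eq_sub_of_hasDerivAt (fun s hs => hx s (hsub hs))
    hI.intervalIntegrable, hx0]
  abel

theorem dense_continuous_control (T : ℝ) :
    Dense {u : Control T | ∃ c : ℝ → ℝ, Continuous c ∧
      ∀ᵐ s ∂(volume.restrict (Set.Icc 0 T)), u s = c s} := by
  refine (BoundedContinuousFunction.toLp_denseRange ℝ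
    (volume.restrict (Set.Icc (0 : ℝ) T)) ℝ (p := 2) (by norm_num)).mono ?_
  rintro _ ⟨c, rfl⟩
  exact ⟨c, c.continuous, BoundedContinuousFunction.coeFn_toLp (p := 2) (𝕜 := ℝ) _ c⟩

end ContinuousControl

/-! ### Compactness of the unitary orbit -/

section Orbit

variable {n : ℕ}

theorem isCompact_unitaryGroup :
    IsCompact (Matrix.unitaryGroup (Fin n) ℂ : Set (Matrix (Fin n) (Fin n) ℂ)) := by
  refine Metric.isCompact_of_isClosed_isBounded ?_ ?_
  · have : (Matrix.unitaryGroup (Fin n) ℂ : Set (Matrix (Fin n) (Fin n) ℂ))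
        = {U | U * star U = 1} := by
      ext U
      exact Matrix.mem_unitaryGroup_iff
    rw [this]
    exact isClosed_eq (by fun_prop) continuous_const
  · refine (Metric.isBounded_closedBall (x := 0) (r := 1)).subset fun U hU => ?_
    rw [mem_closedBall_zero_iff]
    rcases subsingleton_or_nontrivial (Matrix (Fin n) (Fin n) ℂ) with h | h
    · rw [Subsingleton.elim U 0, norm_zero]
      exact zero_le_one
    · exact (CStarRing.norm_of_mem_unitary hU).le

/-- Scaling `U` by an `n`-th root of `(det U)⁻¹` normalises the determinant; the scalar has modulus
one and cancels in the conjugation. -/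
theorem mem_unitaryOrbit_iff {ρ A : Matrix (Fin n) (Fin n) ℂ} :
    A ∈ unitaryOrbit ρ ↔ ∃ U ∈ Matrix.unitaryGroup (Fin n) ℂ, A = U * ρ * Uᴴ := by
  constructor
  · rintro ⟨U, hU, rfl⟩
    exact ⟨U, (Matrix.mem_specialUnitaryGroup_iff.1 hU).1, rfl⟩
  · rintro ⟨U, hU, rfl⟩
    obtain ⟨z, hz, hz'⟩ : ∃ z : ℂ, z ^ n * U.det = 1 ∧ z * star z = 1 := by
      have hd : U.det * star U.det = 1 := (Matrix.det_of_mem_unitary hU).2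
      have hd0 : U.det ≠ 0 := left_ne_zero_of_mul_eq_one hd
      rcases Nat.eq_zero_or_pos n with rfl | hn
      · exact ⟨1, by simp, by simp⟩
      · obtain ⟨z, hz⟩ := IsAlgClosed.exists_pow_nat_eq (U.det)⁻¹ hn
        refine ⟨z, by rw [hz, inv_mul_cancel₀ hd0], ?_⟩
        have h1 : ‖U.det‖ = 1 := by
          have := congrArg norm hd
          rw [norm_mul, norm_star, norm_one, ← sq] at this
          exact (pow_eq_one_iff_of_nonneg (norm_nonneg _) two_ne_zero).1 this
        have h2 : ‖z‖ = 1 := by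
          have := congrArg norm hz
          rw [norm_pow, norm_inv, h1, inv_one] at this
          exact (pow_eq_one_iff_of_nonneg (norm_nonneg _) hn.ne').1 this
        change z * (starRingEnd ℂ) z = 1
        rw [Complex.mul_conj, Complex.normSq_eq_norm_sq, h2]
        simp
    have hU' := Matrix.mem_unitaryGroup_iff.1 hU
    refine ⟨z • U, Matrix.mem_specialUnitaryGroup_iff.2 ⟨Matrix.mem_unitaryGroup_iff.2 ?_, ?_⟩, ?_⟩
    · rw [star_smul, smul_mul_smul_comm, hU', hz', one_smul]
    · rw [Matrix.det_smul, Fintype.card_fin, hz]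
    · rw [Matrix.conjTranspose_smul, Matrix.smul_mul, smul_mul_smul_comm, hz', one_smul]

theorem isClosed_unitaryOrbit (ρ : Matrix (Fin n) (Fin n) ℂ) : IsClosed (unitaryOrbit ρ) := by
  have : unitaryOrbit ρ = (fun U : Matrix (Fin n) (Fin n) ℂ => U * ρ * Uᴴ) ''
      (Matrix.unitaryGroup (Fin n) ℂ : Set (Matrix (Fin n) (Fin n) ℂ)) := by
    ext A
    rw [mem_unitaryOrbit_iff]
    simp only [Set.mem_image, SetLike.mem_coe, eq_comm (a := A)]
  rw [this]
  refine (isCompact_unitaryGroup.image ?_).isClosed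
  exact (continuous_id.mul continuous_const).mul (continuous_star (R := Matrix (Fin n) (Fin n) ℂ))

end Orbit

/-! ### The end-point map of the Liouville–von Neumann equation -/

section Liouville

variable {n : ℕ} {T : ℝ} {H₀ H₁ : Matrix (Fin n) (Fin n) ℂ}

/-- The commutator `ρ ↦ [H, ρ]`. -/
noncomputable def commutatorL (H : Matrix (Fin n) (Fin n) ℂ) :
    Matrix (Fin n) (Fin n) ℂ →L[ℝ] Matrix (Fin n) (Fin n) ℂ :=
  ContinuousLinearMap.mul ℝ _ H - (ContinuousLinearMap.mul ℝ _).flip H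

theorem commutatorL_apply (H ρ : Matrix (Fin n) (Fin n) ℂ) :
    commutatorL H ρ = H * ρ - ρ * H := rfl

theorem isTrajectory_iff (hT : 0 ≤ T) (ρ₀ : Matrix (Fin n) (Fin n) ℂ) (u : Control T)
    (ρ : ℝ → Matrix (Fin n) (Fin n) ℂ) :
    IsTrajectory H₀ H₁ ρ₀ T u ρ ↔
      ∀ t : Set.Icc (0 : ℝ) T, ρ t = flow hT (commutatorL H₀) (commutatorL H₁) ρ₀ u t := by
  rw [← caratheodory_iff, IsTrajectory]
  have : ∀ s, commutatorL H₀ (ρ s) + u s • commutatorL H₁ (ρ s)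
      = (H₀ + u s • H₁) * ρ s - ρ s * (H₀ + u s • H₁) := fun s => by
    rw [commutatorL_apply, commutatorL_apply, add_mul, mul_add, smul_mul_assoc, mul_smul_comm,
      smul_sub]
    abel
  simp only [this]

theorem exists_isTrajectory (hT : 0 ≤ T) (ρ₀ : Matrix (Fin n) (Fin n) ℂ) (u : Control T) :
    ∃ ρ, IsTrajectory H₀ H₁ ρ₀ T u ρ :=
  ⟨Set.IccExtend hT (flow hT (commutatorL H₀) (commutatorL H₁) ρ₀ u),
    (isTrajectory_iff hT ρ₀ u _).2 fun t => Set.IccExtend_of_mem _ _ t.2⟩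

theorem endPoint_eq_flow (hT : 0 ≤ T) (ρ₀ : Matrix (Fin n) (Fin n) ℂ) (u : Control T) :
    endPoint H₀ H₁ ρ₀ T u
      = flow hT (commutatorL H₀) (commutatorL H₁) ρ₀ u ⟨T, Set.right_mem_Icc.2 hT⟩ := by
  have h := exists_isTrajectory (H₀ := H₀) (H₁ := H₁) hT ρ₀ u
  rw [endPoint, dif_pos h]
  exact (isTrajectory_iff hT ρ₀ u _).1 h.choose_spec ⟨T, Set.right_mem_Icc.2 hT⟩

theorem IsTrajectory.apply_eq_endPoint (hT : 0 ≤ T) {ρ₀ : Matrix (Fin n) (Fin n) ℂ}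
    {u : Control T} {ρ : ℝ → Matrix (Fin n) (Fin n) ℂ} (h : IsTrajectory H₀ H₁ ρ₀ T u ρ) :
    ρ T = endPoint H₀ H₁ ρ₀ T u := by
  rw [endPoint_eq_flow hT]
  exact (isTrajectory_iff hT ρ₀ u _).1 h ⟨T, Set.right_mem_Icc.2 hT⟩

theorem contDiff_endPoint (hT : 0 ≤ T) (H₀ H₁ ρ₀ : Matrix (Fin n) (Fin n) ℂ) :
    ContDiff ℝ ∞ (endPoint H₀ H₁ ρ₀ T) := by
  have : endPoint H₀ H₁ ρ₀ T = fun u =>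
      ContinuousMap.evalCLM ℝ (⟨T, Set.right_mem_Icc.2 hT⟩ : Set.Icc (0 : ℝ) T)
        (flow hT (commutatorL H₀) (commutatorL H₁) ρ₀ u) :=
    funext fun u => endPoint_eq_flow hT ρ₀ u
  rw [this]
  exact (ContinuousLinearMap.contDiff _).comp (contDiff_flow hT _ _ _)

/-- For a continuous control the propagator `X` of `X' = (H₀ + c H₁) X` stays unitary since the
generator is skew-Hermitian, and `X ρ₀ X†` solves the equation. The orbit is closed, so the other
controls follow by density. -/
theorem endPoint_mem_unitaryOrbit (hT : 0 ≤ T) (hH₀ : H₀ᴴ = -H₀) (hH₁ : H₁ᴴ = -H₁)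
    (ρ₀ : Matrix (Fin n) (Fin n) ℂ) (u : Control T) :
    endPoint H₀ H₁ ρ₀ T u ∈ unitaryOrbit ρ₀ := by
  have hclosed : IsClosed (endPoint H₀ H₁ ρ₀ T ⁻¹' unitaryOrbit ρ₀) :=
    (isClosed_unitaryOrbit ρ₀).preimage (contDiff_endPoint hT H₀ H₁ ρ₀).continuous
  have hsub : {u : Control T | ∃ c : ℝ → ℝ, Continuous c ∧
      ∀ᵐ s ∂(volume.restrict (Set.Icc 0 T)), u s = c s} ⊆
        endPoint H₀ H₁ ρ₀ T ⁻¹' unitaryOrbit ρ₀ := by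
    rintro u ⟨c, hc, hu⟩
    obtain ⟨X, hX0, hX, -⟩ := exists_hasDerivAt_flow hT (ContinuousLinearMap.mul ℝ _ H₀)
      (ContinuousLinearMap.mul ℝ _ H₁) (1 : Matrix (Fin n) (Fin n) ℂ) u hc hu
    have hX' : ∀ t ∈ Set.Icc 0 T, HasDerivAt X ((H₀ + c t • H₁) * X t) t := fun t ht => by
      have := hX t ht
      rwa [ContinuousLinearMap.mul_apply', ContinuousLinearMap.mul_apply', ← smul_mul_assoc,
        ← add_mul] at this
    have hskew : ∀ t, star (H₀ + c t • H₁) = -(H₀ + c t • H₁) := fun t => by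
      rw [star_add, star_smul, Matrix.star_eq_conjTranspose, Matrix.star_eq_conjTranspose, hH₀, hH₁]
      simp [add_comm]
    have hXs : ∀ t ∈ Set.Icc 0 T,
        HasDerivAt (fun t => star (X t)) (-(star (X t) * (H₀ + c t • H₁))) t := fun t ht => by
      have := (hX' t ht).star
      rwa [star_mul, hskew, mul_neg] at this
    have hunit : ∀ t ∈ Set.Icc 0 T, star (X t) * X t = 1 := by
      have h1 : ∀ t ∈ Set.Icc 0 T, HasDerivAt (fun t => star (X t) * X t) 0 t := fun t ht => by
        refine ((hXs t ht).mul (hX' t ht)).congr_deriv ?_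
        noncomm_ring
      intro t ht
      rw [constant_of_has_deriv_right_zero
        (fun t ht => (h1 t ht).continuousAt.continuousWithinAt)
        (fun t ht => (h1 t (Set.Ico_subset_Icc_self ht)).hasDerivWithinAt) t ht, hX0]
      simp
    have hρ := eq_flow_of_hasDerivAt hT (commutatorL H₀) (commutatorL H₁) ρ₀ u hc hu
      (x := fun t => X t * ρ₀ * star (X t)) (by simp [hX0]) (fun t ht => by
        refine (((hX' t ht).mul_const ρ₀).mul (hXs t ht)).congr_deriv ?_
        rw [commutatorL_apply, commutatorL_apply]
        simp only [add_mul, mul_add, smul_mul_assoc, mul_smul_comm, smul_sub, mul_neg, mul_assoc]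
        abel) ⟨T, Set.right_mem_Icc.2 hT⟩
    refine mem_unitaryOrbit_iff.2 ⟨X T, Matrix.mem_unitaryGroup_iff'.2
      (hunit T (Set.right_mem_Icc.2 hT)), ?_⟩
    rw [endPoint_eq_flow hT]
    exact hρ.symm
  exact hclosed.closure_subset_iff.2 hsub (dense_continuous_control T u)

end Liouville

/-! ### Tangent spaces of the orbit and pulling back critical points -/

section Tangent

theorem map_mem_tangentVectors {E F : Type*} [NormedAddCommGroup E] [NormedSpace ℝ E]
    [NormedAddCommGroup F] [NormedSpace ℝ F] {f : E → F} (hf : ContDiff ℝ ∞ f)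
    {S : Set E} {S' : Set F} (hS : Set.MapsTo f S S') {x v : E} (hv : v ∈ tangentVectors S x) :
    fderiv ℝ f x v ∈ tangentVectors S' (f x) := by
  obtain ⟨ε, hε, γ, h1, h2, rfl, h4⟩ := hv
  exact ⟨ε, hε, f ∘ γ, hf.comp_contDiffOn h1, fun t ht => hS (h2 t ht), rfl,
    (hf.differentiable (by simp) _).hasFDerivAt.comp_hasDerivAt 0 h4⟩

theorem mem_tangentVectors_univ {E : Type*} [NormedAddCommGroup E] [NormedSpace ℝ E] (x v : E) :
    v ∈ tangentVectors Set.univ x := by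
  refine ⟨1, one_pos, fun t => x + t • v, by fun_prop, fun _ _ => trivial, by simp, ?_⟩
  simpa using ((hasDerivAt_id (0 : ℝ)).smul_const v).const_add x

variable {n : ℕ}

/-- The conjugation `A ↦ U A U†`. -/
noncomputable def conjL (U : Matrix (Fin n) (Fin n) ℂ) :
    Matrix (Fin n) (Fin n) ℂ →L[ℝ] Matrix (Fin n) (Fin n) ℂ :=
  (ContinuousLinearMap.mul ℝ _ U).comp ((ContinuousLinearMap.mul ℝ _).flip Uᴴ)

theorem conjL_apply (U A : Matrix (Fin n) (Fin n) ℂ) : conjL U A = U * A * Uᴴ :=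
  (mul_assoc _ _ _).symm

theorem conjL_mem_unitaryOrbit {U : Matrix (Fin n) (Fin n) ℂ}
    (hU : U ∈ Matrix.unitaryGroup (Fin n) ℂ) {ρ A : Matrix (Fin n) (Fin n) ℂ}
    (hA : A ∈ unitaryOrbit ρ) : conjL U A ∈ unitaryOrbit ρ := by
  obtain ⟨V, hV, rfl⟩ := mem_unitaryOrbit_iff.1 hA
  refine mem_unitaryOrbit_iff.2 ⟨U * V, mul_mem hU hV, ?_⟩
  rw [conjL_apply, Matrix.conjTranspose_mul]
  simp only [mul_assoc]

theorem finrank_tangent_le_conjL {U : Matrix (Fin n) (Fin n) ℂ}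
    (hU : U ∈ Matrix.unitaryGroup (Fin n) ℂ) (ρ A : Matrix (Fin n) (Fin n) ℂ) :
    Module.finrank ℝ (Submodule.span ℝ (tangentVectors (unitaryOrbit ρ) A)) ≤
      Module.finrank ℝ (Submodule.span ℝ (tangentVectors (unitaryOrbit ρ) (conjL U A))) := by
  have hinj : Function.Injective (conjL U).toLinearMap := by
    refine Function.LeftInverse.injective (g := conjL Uᴴ) fun A => ?_
    change conjL Uᴴ (conjL U A) = A
    have hU' : Uᴴ * U = 1 := Matrix.mem_unitaryGroup_iff'.1 hU
    rw [conjL_apply, conjL_apply, Matrix.conjTranspose_conjTranspose]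
    calc _ = (Uᴴ * U) * A * (Uᴴ * U) := by simp only [mul_assoc]
      _ = A := by rw [hU', one_mul, mul_one]
  rw [(Submodule.equivMapOfInjective _ hinj _).finrank_eq]
  refine Submodule.finrank_mono ?_
  rw [Submodule.map_span]
  refine Submodule.span_mono ?_
  rintro _ ⟨v, hv, rfl⟩
  have := map_mem_tangentVectors (conjL U).contDiff
    (fun A hA => conjL_mem_unitaryOrbit hU (ρ := ρ) hA) hv
  rwa [ContinuousLinearMap.fderiv] at this

/-- The orbit is homogeneous: conjugation by `U` and by `U†` each carry its tangent vectors
injectively, giving both inequalities. This moves `orbitDim`, defined at `ρ₀`, to any end point. -/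
theorem finrank_tangent_eq_orbitDim {ρ₀ ρ : Matrix (Fin n) (Fin n) ℂ}
    (hρ : ρ ∈ unitaryOrbit ρ₀) :
    Module.finrank ℝ (Submodule.span ℝ (tangentVectors (unitaryOrbit ρ₀) ρ)) = orbitDim ρ₀ := by
  obtain ⟨U, hU, rfl⟩ := mem_unitaryOrbit_iff.1 hρ
  have hU' : Uᴴ * U = 1 := Matrix.mem_unitaryGroup_iff'.1 hU
  rw [← conjL_apply]
  refine le_antisymm ?_ (finrank_tangent_le_conjL hU ρ₀ ρ₀)
  have h := finrank_tangent_le_conjL (Unitary.star_mem hU) ρ₀ (conjL U ρ₀)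
  have h2 : conjL (star U) (conjL U ρ₀) = ρ₀ := by
    rw [conjL_apply, conjL_apply, Matrix.star_eq_conjTranspose, Matrix.conjTranspose_conjTranspose]
    calc _ = (Uᴴ * U) * ρ₀ * (Uᴴ * U) := by simp only [mul_assoc]
      _ = ρ₀ := by rw [hU', one_mul, mul_one]
  rwa [h2] at h

variable {T : ℝ} {H₀ H₁ ρ₀ : Matrix (Fin n) (Fin n) ℂ}

/-- The image of a line of controls is a curve in the orbit, which gives one inclusion; regularity
gives equal dimensions. -/
theorem range_fderiv_endPoint (hT : 0 ≤ T) (hH₀ : H₀ᴴ = -H₀) (hH₁ : H₁ᴴ = -H₁) {u : Control T}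
    (hu : IsRegularControl H₀ H₁ ρ₀ T u) :
    LinearMap.range (fderiv ℝ (endPoint H₀ H₁ ρ₀ T) u).toLinearMap
      = Submodule.span ℝ (tangentVectors (unitaryOrbit ρ₀) (endPoint H₀ H₁ ρ₀ T u)) := by
  refine Submodule.eq_of_le_of_finrank_eq ?_ ?_
  · rintro _ ⟨v, rfl⟩
    exact Submodule.subset_span (map_mem_tangentVectors (contDiff_endPoint hT H₀ H₁ ρ₀)
      (fun u _ => endPoint_mem_unitaryOrbit hT hH₀ hH₁ ρ₀ u) (mem_tangentVectors_univ u v))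
  · rw [finrank_tangent_eq_orbitDim (endPoint_mem_unitaryOrbit hT hH₀ hH₁ ρ₀ u)]
    exact hu

/-- The cost as a continuous linear functional. -/
noncomputable def costL (θ : Matrix (Fin n) (Fin n) ℂ) : Matrix (Fin n) (Fin n) ℂ →L[ℝ] ℝ :=
  Complex.reCLM.comp
    ((LinearMap.toContinuousLinearMap (Matrix.traceLinearMap (Fin n) ℝ ℂ)).comp
      ((ContinuousLinearMap.mul ℝ _).flip θ))

theorem cost_eq_costL (θ : Matrix (Fin n) (Fin n) ℂ) : cost θ = costL θ := rfl

theorem mem_criticalPointsOn_cost_iff {θ ρ : Matrix (Fin n) (Fin n) ℂ}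
    {S : Set (Matrix (Fin n) (Fin n) ℂ)} :
    ρ ∈ criticalPointsOn (cost θ) S ↔ ρ ∈ S ∧ ∀ v ∈ tangentVectors S ρ, cost θ v = 0 := by
  rw [cost_eq_costL, criticalPointsOn, Set.mem_ofPred_eq, ContinuousLinearMap.fderiv]
  simp only [(costL θ).differentiableAt, true_and]

theorem criticalPoints_controlCost (hT : 0 ≤ T) (hH₀ : H₀ᴴ = -H₀) (hH₁ : H₁ᴴ = -H₁)
    (hreg : ∀ u : Control T, IsRegularControl H₀ H₁ ρ₀ T u) (θ : Matrix (Fin n) (Fin n) ℂ) :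
    criticalPoints (controlCost H₀ H₁ ρ₀ θ T)
      = endPoint H₀ H₁ ρ₀ T ⁻¹' criticalPointsOn (cost θ) (unitaryOrbit ρ₀) := by
  ext u
  have hE : HasFDerivAt (endPoint H₀ H₁ ρ₀ T) (fderiv ℝ (endPoint H₀ H₁ ρ₀ T) u) u :=
    ((contDiff_endPoint hT H₀ H₁ ρ₀).differentiable (by simp) u).hasFDerivAt
  have hJ : HasFDerivAt (controlCost H₀ H₁ ρ₀ θ T)
      ((costL θ).comp (fderiv ℝ (endPoint H₀ H₁ ρ₀ T) u)) u :=
    (costL θ).hasFDerivAt.comp u hE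
  have hr := range_fderiv_endPoint hT hH₀ hH₁ (hreg u)
  rw [Set.mem_preimage, mem_criticalPointsOn_cost_iff, cost_eq_costL]
  constructor
  · intro h
    refine ⟨endPoint_mem_unitaryOrbit hT hH₀ hH₁ ρ₀ u, fun v hv => ?_⟩
    have hv' := Submodule.subset_span (R := ℝ) hv
    rw [← hr] at hv'
    obtain ⟨w, rfl⟩ := hv'
    exact congrArg (fun L : Control T →L[ℝ] ℝ => L w) (hJ.unique h)
  · rintro ⟨-, h⟩
    have hle : Submodule.span ℝ (tangentVectors (unitaryOrbit ρ₀) (endPoint H₀ H₁ ρ₀ T u))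
        ≤ LinearMap.ker (costL θ).toLinearMap := Submodule.span_le.2 h
    rw [← hr] at hle
    refine hJ.congr_fderiv (ContinuousLinearMap.ext fun w => ?_)
    exact hle ⟨w, rfl⟩

end Tangent

/-! ### First-order conditions on the orbit -/

section CriticalPoints

variable {n : ℕ}

/-- The curve is `exp(tX) ρ exp(tX)†`. -/
theorem commutator_mem_tangentVectors {ρ₀ ρ X : Matrix (Fin n) (Fin n) ℂ}
    (hρ : ρ ∈ unitaryOrbit ρ₀) (hX : Xᴴ = -X) :
    X * ρ - ρ * X ∈ tangentVectors (unitaryOrbit ρ₀) ρ := by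
  have hd : ∀ t : ℝ, HasDerivAt (fun t : ℝ => NormedSpace.exp (t • X))
      (NormedSpace.exp (t • X) * X) t := fun t => hasDerivAt_exp_smul_const X t
  have hs : ContDiff ℝ ∞ fun t : ℝ => NormedSpace.exp (t • X) := by
    have h : ContDiff ℝ ∞ (NormedSpace.exp : Matrix (Fin n) (Fin n) ℂ → _) :=
      contDiff_iff_contDiffAt.2 fun x => (NormedSpace.exp_analytic (𝕂 := ℝ) x).contDiffAt
    exact h.comp (contDiff_id.smul contDiff_const)
  refine ⟨1, one_pos, fun t => NormedSpace.exp (t • X) * ρ * star (NormedSpace.exp (t • X)),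
    ?_, fun t _ => ?_, by simp, ?_⟩
  · have h2 : ContDiff ℝ ∞ fun t : ℝ => star (NormedSpace.exp (t • X)) :=
      (starL' ℝ : Matrix (Fin n) (Fin n) ℂ ≃L[ℝ] _).contDiff.comp hs
    exact ((hs.mul contDiff_const).mul h2).contDiffOn
  · have hU : NormedSpace.exp (t • X) ∈ Matrix.unitaryGroup (Fin n) ℂ := by
      let _ : NormedAlgebra ℚ (Matrix (Fin n) (Fin n) ℂ) := NormedAlgebra.restrictScalars ℚ ℝ _
      refine NormedSpace.exp_mem_unitary_of_mem_skewAdjoint ?_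
      rw [skewAdjoint.mem_iff, star_smul, Matrix.star_eq_conjTranspose, hX]
      simp
    have := conjL_mem_unitaryOrbit hU hρ
    rwa [conjL_apply] at this
  · refine (((hd 0).mul_const ρ).mul (hd 0).star).congr_deriv ?_
    simp [Matrix.star_eq_conjTranspose, hX, sub_eq_add_neg]

open scoped ComplexOrder in
-- `[ρ, θ]` is itself skew-Hermitian, hence an admissible direction `X`, and cyclicity of the trace
-- turns the derivative of the cost along it into `-tr(X†X)`.
theorem commute_of_mem_criticalPointsOn {ρ₀ ρ θ : Matrix (Fin n) (Fin n) ℂ}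
    (hρ₀ : ρ₀.IsHermitian) (hθ : θ.IsHermitian)
    (h : ρ ∈ criticalPointsOn (cost θ) (unitaryOrbit ρ₀)) : ρ * θ = θ * ρ := by
  obtain ⟨hρ, hv⟩ := mem_criticalPointsOn_cost_iff.1 h
  have hρH : ρᴴ = ρ := by
    obtain ⟨U, -, rfl⟩ := hρ
    exact Matrix.isHermitian_mul_mul_conjTranspose U hρ₀
  set X := ρ * θ - θ * ρ with hXdef
  have hX : Xᴴ = -X := by
    rw [hXdef, Matrix.conjTranspose_sub, Matrix.conjTranspose_mul, Matrix.conjTranspose_mul, hρH,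
      hθ.eq, neg_sub]
  have h1 := hv _ (commutator_mem_tangentVectors hρ hX)
  have h2 : Matrix.trace ((X * ρ - ρ * X) * θ) = -Matrix.trace (Xᴴ * X) := by
    have : ∀ Y, Matrix.trace ((Y * ρ - ρ * Y) * θ) = Matrix.trace (Y * (ρ * θ - θ * ρ)) := by
      intro Y
      rw [sub_mul, mul_sub, Matrix.trace_sub, Matrix.trace_sub, mul_assoc ρ,
        Matrix.trace_mul_comm ρ, mul_assoc, mul_assoc]
    rw [this, hX, neg_mul, Matrix.trace_neg, neg_neg]
  have h3 : 0 ≤ Matrix.trace (Xᴴ * X) := (Matrix.posSemidef_conjTranspose_mul_self X).trace_nonneg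
  have h4 : Matrix.trace (Xᴴ * X) = 0 := by
    rw [cost, h2, Complex.neg_re, neg_eq_zero] at h1
    exact Complex.ext h1 (Complex.le_def.1 h3).2.symm
  exact sub_eq_zero.1 (Matrix.trace_conjTranspose_mul_self_eq_zero_iff.1 h4)

theorem trace_pow_of_mem_unitaryOrbit {ρ₀ ρ : Matrix (Fin n) (Fin n) ℂ}
    (hρ : ρ ∈ unitaryOrbit ρ₀) (k : ℕ) : (ρ ^ k).trace = (ρ₀ ^ k).trace := by
  obtain ⟨U, hU, rfl⟩ := mem_unitaryOrbit_iff.1 hρ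
  have hU' : Uᴴ * U = 1 := Matrix.mem_unitaryGroup_iff'.1 hU
  have hU'' : U * Uᴴ = 1 := Matrix.mem_unitaryGroup_iff.1 hU
  have h : (U * ρ₀ * Uᴴ) ^ k = U * ρ₀ ^ k * Uᴴ := by
    induction k with
    | zero => simp [hU'']
    | succ k ih =>
      rw [pow_succ, ih, pow_succ]
      calc _ = U * ρ₀ ^ k * (Uᴴ * U) * ρ₀ * Uᴴ := by simp only [mul_assoc]
        _ = _ := by rw [hU', mul_one]; simp only [mul_assoc]
  rw [h, Matrix.trace_mul_comm, ← mul_assoc, hU', one_mul]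

/-- Differentiating the constant `tr γᵏ⁺¹` gives `(k + 1) tr(ρᵏ v)` by cyclicity. -/
theorem trace_pow_mul_tangent {ρ₀ ρ v : Matrix (Fin n) (Fin n) ℂ}
    (hv : v ∈ tangentVectors (unitaryOrbit ρ₀) ρ) (k : ℕ) : (ρ ^ k * v).trace = 0 := by
  obtain ⟨ε, hε, γ, -, hγ, rfl, hγ'⟩ := hv
  let τ := LinearMap.toContinuousLinearMap (Matrix.traceLinearMap (Fin n) ℝ ℂ)
  have h1 := τ.hasFDerivAt.comp_hasDerivAt (0 : ℝ) (hγ'.fun_pow' (k + 1))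
  have h2 : (τ ∘ fun t => γ t ^ (k + 1)) =ᶠ[𝓝 0] fun _ => (ρ₀ ^ (k + 1)).trace := by
    filter_upwards [Ioo_mem_nhds (neg_lt_zero.2 hε) hε] with t ht
      using trace_pow_of_mem_unitaryOrbit (hγ t ht) (k + 1)
  have h3 := h1.unique ((hasDerivAt_const _ _).congr_of_eventuallyEq h2)
  have h4 : ∀ i ∈ Finset.range (k + 1),
      (γ 0 ^ (k - i) * v * γ 0 ^ i).trace = (γ 0 ^ k * v).trace := by
    intro i hi
    rw [Matrix.trace_mul_comm, ← mul_assoc, ← pow_add]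
    congr 3
    have := Finset.mem_range.1 hi
    omega
  change (∑ i ∈ Finset.range (k + 1), γ 0 ^ (k - i) * v * γ 0 ^ i).trace = 0 at h3
  rw [Matrix.trace_sum, Finset.sum_congr rfl h4, Finset.sum_const, Finset.card_range,
    nsmul_eq_mul] at h3
  exact (mul_eq_zero.1 h3).resolve_left (by exact_mod_cast k.succ_ne_zero)

end CriticalPoints

/-! ### Classification and enumeration of the critical points -/

section Classification

variable {n : ℕ}

theorem exists_unitary_diagonalization {A : Matrix (Fin n) (Fin n) ℂ} (hA : A.IsHermitian) :
    ∃ W ∈ Matrix.unitaryGroup (Fin n) ℂ,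
      A = W * Matrix.diagonal (fun i => (hA.eigenvalues i : ℂ)) * Wᴴ :=
  ⟨hA.eigenvectorUnitary, hA.eigenvectorUnitary.2, hA.spectral_theorem⟩

/-- The matrix with the eigenvalues `lam ∘ π` in the eigenbasis given by the columns of `W`. -/
noncomputable def diagonalIn (W : Matrix (Fin n) (Fin n) ℂ) (lam : Fin n → ℝ)
    (π : Equiv.Perm (Fin n)) : Matrix (Fin n) (Fin n) ℂ :=
  W * Matrix.diagonal (fun i => (lam (π i) : ℂ)) * Wᴴ

theorem diagonalIn_injective {W : Matrix (Fin n) (Fin n) ℂ}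
    (hW : W ∈ Matrix.unitaryGroup (Fin n) ℂ) {lam : Fin n → ℝ} (hlam : Function.Injective lam) :
    Function.Injective (diagonalIn W lam) := by
  intro π σ h
  have hW' : Wᴴ * W = 1 := Matrix.mem_unitaryGroup_iff'.1 hW
  have key : ∀ π, Wᴴ * diagonalIn W lam π * W = Matrix.diagonal (fun i => (lam (π i) : ℂ)) := by
    intro π
    calc _ = (Wᴴ * W) * Matrix.diagonal (fun i => (lam (π i) : ℂ)) * (Wᴴ * W) := by
          simp only [diagonalIn, mul_assoc]
      _ = _ := by rw [hW', one_mul, mul_one]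
  have h2 := Matrix.diagonal_injective ((key π).symm.trans ((congrArg (Wᴴ * · * W) h).trans (key σ)))
  refine Equiv.ext fun i => hlam ?_
  exact_mod_cast congrFun h2 i

theorem diagonalIn_mem_unitaryOrbit {W V : Matrix (Fin n) (Fin n) ℂ}
    (hW : W ∈ Matrix.unitaryGroup (Fin n) ℂ) (hV : V ∈ Matrix.unitaryGroup (Fin n) ℂ)
    (lam : Fin n → ℝ) (π : Equiv.Perm (Fin n)) :
    diagonalIn W lam π ∈
      unitaryOrbit (V * Matrix.diagonal (fun i => (lam i : ℂ)) * Vᴴ) := by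
  set D := Matrix.diagonal (fun i => (lam i : ℂ)) with hD
  -- Permuting the columns of the eigenbasis realises the permutation of the eigenvalues.
  set P := W.submatrix id π.symm with hP
  have hPP : P * Pᴴ = 1 := by
    rw [hP, Matrix.conjTranspose_submatrix, Matrix.submatrix_mul_equiv, Matrix.submatrix_id_id]
    exact Matrix.mem_unitaryGroup_iff.1 hW
  have hPD : P * D * Pᴴ = diagonalIn W lam π := by
    have : D = (Matrix.diagonal fun i => (lam (π i) : ℂ)).submatrix π.symm π.symm := by
      rw [Matrix.submatrix_diagonal_equiv, hD]
      congr 1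
      ext i
      simp
    rw [this, hP, Matrix.conjTranspose_submatrix, Matrix.submatrix_mul_equiv,
      Matrix.submatrix_mul_equiv, Matrix.submatrix_id_id, diagonalIn]
  have hV' : Vᴴ * V = 1 := Matrix.mem_unitaryGroup_iff'.1 hV
  refine mem_unitaryOrbit_iff.2 ⟨P * Vᴴ,
    mul_mem (Matrix.mem_unitaryGroup_iff.2 hPP) (Unitary.star_mem hV), ?_⟩
  rw [← hPD, Matrix.conjTranspose_mul, Matrix.conjTranspose_conjTranspose]
  calc P * D * Pᴴ = P * (Vᴴ * V) * D * (Vᴴ * V) * Pᴴ := by rw [hV', mul_one, mul_one]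
    _ = _ := by simp only [mul_assoc]

theorem charpoly_conj {U : Matrix (Fin n) (Fin n) ℂ}
    (hU : U ∈ Matrix.unitaryGroup (Fin n) ℂ) (A : Matrix (Fin n) (Fin n) ℂ) :
    (U * A * Uᴴ).charpoly = A.charpoly := by
  have hU' : Uᴴ * U = 1 := Matrix.mem_unitaryGroup_iff'.1 hU
  rw [Matrix.charpoly_mul_comm, ← mul_assoc, hU', one_mul]

/-- The diagonals agree as multisets of roots; having no repetitions, they are matched by an
injective, hence bijective, choice of indices. -/
theorem exists_perm_of_charpoly_diagonal_eq {d : Fin n → ℂ} {lam : Fin n → ℝ}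
    (hlam : Function.Injective lam)
    (h : (Matrix.diagonal d).charpoly = (Matrix.diagonal fun i => (lam i : ℂ)).charpoly) :
    ∃ π : Equiv.Perm (Fin n), ∀ i, d i = lam (π i) := by
  have hm : Multiset.map d Finset.univ.val
      = Multiset.map (fun i => (lam i : ℂ)) Finset.univ.val := by
    rw [Matrix.charpoly_diagonal, Matrix.charpoly_diagonal] at h
    have key : ∀ e : Fin n → ℂ, (∏ i, (Polynomial.X - Polynomial.C (e i))).roots
        = Multiset.map e Finset.univ.val := fun e => by
      rw [← Polynomial.roots_multiset_prod_X_sub_C (Multiset.map e Finset.univ.val),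
        Multiset.map_map]
      rfl
    rw [← key, ← key, h]
  have hmem : ∀ i, ∃ j, (lam j : ℂ) = d i := fun i => by
    have : d i ∈ Multiset.map d Finset.univ.val := Multiset.mem_map_of_mem d (Finset.mem_univ i)
    rw [hm] at this
    obtain ⟨j, -, hj⟩ := Multiset.mem_map.1 this
    exact ⟨j, hj⟩
  choose π hπ using hmem
  have hd : Function.Injective d := by
    have hnd : (Multiset.map d Finset.univ.val).Nodup := by
      rw [hm]
      exact Finset.univ.nodup.map (Complex.ofReal_injective.comp hlam)
    intro i j hij
    exact Multiset.inj_on_of_nodup_map hnd i (Finset.mem_univ i) j (Finset.mem_univ j) hij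
  have hinj : Function.Injective π := fun i j hij => hd (by rw [← hπ i, ← hπ j, hij])
  exact ⟨Equiv.ofBijective π (Finite.injective_iff_bijective.1 hinj), fun i => (hπ i).symm⟩

theorem exists_perm_of_commute {W V ρ : Matrix (Fin n) (Fin n) ℂ}
    (hW : W ∈ Matrix.unitaryGroup (Fin n) ℂ) (hV : V ∈ Matrix.unitaryGroup (Fin n) ℂ)
    {lam τ : Fin n → ℝ} (hlam : Function.Injective lam) (hτ : Function.Injective τ)
    (hρ : ρ ∈ unitaryOrbit (V * Matrix.diagonal (fun i => (lam i : ℂ)) * Vᴴ))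
    (hcomm : ρ * (W * Matrix.diagonal (fun i => (τ i : ℂ)) * Wᴴ)
      = (W * Matrix.diagonal (fun i => (τ i : ℂ)) * Wᴴ) * ρ) :
    ∃ π, ρ = diagonalIn W lam π := by
  have hW' : Wᴴ * W = 1 := Matrix.mem_unitaryGroup_iff'.1 hW
  have hW'' : W * Wᴴ = 1 := Matrix.mem_unitaryGroup_iff.1 hW
  set D := Matrix.diagonal (fun i => (τ i : ℂ)) with hD
  set B := Wᴴ * ρ * W with hB
  have hρB : ρ = W * B * Wᴴ := by
    calc ρ = (W * Wᴴ) * ρ * (W * Wᴴ) := by rw [hW'', one_mul, mul_one]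
      _ = _ := by simp only [hB, mul_assoc]
  have hBD : B * D = D * B := by
    calc B * D = Wᴴ * (ρ * (W * D * Wᴴ)) * W := by
          calc B * D = Wᴴ * ρ * W * D * (Wᴴ * W) := by rw [hW', mul_one]
            _ = _ := by simp only [mul_assoc]
      _ = Wᴴ * ((W * D * Wᴴ) * ρ) * W := by rw [hcomm]
      _ = (Wᴴ * W) * D * B := by simp only [hB, mul_assoc]
      _ = D * B := by rw [hW', one_mul]
  -- The `(i, j)` entry of `BD = DB` gives `(τ j - τ i) B i j = 0`, and the `τ i` are distinct.
  have hBdiag : B = Matrix.diagonal fun i => B i i := by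
    ext i j
    rcases eq_or_ne i j with rfl | hij
    · simp
    · rw [Matrix.diagonal_apply_ne _ hij]
      have h1 := congrFun (congrFun hBD i) j
      rw [hD, Matrix.mul_diagonal, Matrix.diagonal_mul, mul_comm, ← sub_eq_zero, ← sub_mul] at h1
      refine (mul_eq_zero.1 h1).resolve_left fun h2 => hij (hτ ?_)
      exact_mod_cast (sub_eq_zero.1 h2).symm
  obtain ⟨U, hU, hρU⟩ := mem_unitaryOrbit_iff.1 hρ
  obtain ⟨π, hπ⟩ := exists_perm_of_charpoly_diagonal_eq (d := fun i => B i i) hlam (by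
    rw [← hBdiag, ← charpoly_conj hW, ← hρB, hρU, charpoly_conj hU, charpoly_conj hV])
  refine ⟨π, ?_⟩
  rw [diagonalIn, hρB, hBdiag]
  simp only [hπ]

theorem cost_tangent_diagonalIn {W ρ₀ v : Matrix (Fin n) (Fin n) ℂ}
    (hW : W ∈ Matrix.unitaryGroup (Fin n) ℂ)
    {lam τ : Fin n → ℝ} (hlam : Function.Injective lam) (π : Equiv.Perm (Fin n))
    (hv : v ∈ tangentVectors (unitaryOrbit ρ₀) (diagonalIn W lam π)) :
    cost (W * Matrix.diagonal (fun i => (τ i : ℂ)) * Wᴴ) v = 0 := by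
  have hW' : Wᴴ * W = 1 := Matrix.mem_unitaryGroup_iff'.1 hW
  have hW'' : W * Wᴴ = 1 := Matrix.mem_unitaryGroup_iff.1 hW
  set B := Wᴴ * v * W with hB
  have htr : ∀ d : Fin n → ℂ, (W * Matrix.diagonal d * Wᴴ * v).trace = ∑ i, B i i * d i := by
    intro d
    have h1 : (W * Matrix.diagonal d * Wᴴ * v).trace = (B * Matrix.diagonal d).trace := by
      rw [hB, Matrix.trace_mul_comm (Wᴴ * v * W), mul_assoc, mul_assoc, Matrix.trace_mul_comm]
      simp only [mul_assoc]
    rw [h1, Matrix.trace]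
    simp only [Matrix.diag_apply, Matrix.mul_diagonal]
  have hpow : ∀ k : ℕ, diagonalIn W lam π ^ k
      = W * Matrix.diagonal (fun i => (lam (π i) : ℂ) ^ k) * Wᴴ := by
    intro k
    induction k with
    | zero => simp [hW'']
    | succ k ih =>
      rw [pow_succ, ih, diagonalIn]
      calc _ = W * (Matrix.diagonal (fun i => (lam (π i) : ℂ) ^ k) * (Wᴴ * W) *
            Matrix.diagonal (fun i => (lam (π i) : ℂ))) * Wᴴ := by simp only [mul_assoc]
        _ = _ := by rw [hW', mul_one, Matrix.diagonal_mul_diagonal]; simp only [pow_succ]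
  -- The relations `tr(ρʲ v) = 0` form a Vandermonde system for the diagonal of `B`, with distinct
  -- nodes `lam (π i)`.
  have hz : (fun i => B i i) = 0 := by
    refine Matrix.eq_zero_of_forall_pow_sum_mul_pow_eq_zero
      (f := fun i => (lam (π i) : ℂ))
      (Complex.ofReal_injective.comp (hlam.comp π.injective)) fun j => ?_
    rw [← htr, ← hpow]
    exact trace_pow_mul_tangent hv j
  rw [cost, Matrix.trace_mul_comm, htr]
  simp [fun i => congrFun hz i]

theorem criticalPointsOn_cost_eq_range {W V : Matrix (Fin n) (Fin n) ℂ}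
    (hW : W ∈ Matrix.unitaryGroup (Fin n) ℂ) (hV : V ∈ Matrix.unitaryGroup (Fin n) ℂ)
    {lam τ : Fin n → ℝ} (hlam : Function.Injective lam) (hτ : Function.Injective τ)
    (hρ₀ : (V * Matrix.diagonal (fun i => (lam i : ℂ)) * Vᴴ).IsHermitian)
    (hθ : (W * Matrix.diagonal (fun i => (τ i : ℂ)) * Wᴴ).IsHermitian) :
    criticalPointsOn (cost (W * Matrix.diagonal (fun i => (τ i : ℂ)) * Wᴴ))
        (unitaryOrbit (V * Matrix.diagonal (fun i => (lam i : ℂ)) * Vᴴ))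
      = Set.range (diagonalIn W lam) := by
  refine Set.Subset.antisymm (fun ρ hρ => ?_) ?_
  · obtain ⟨π, rfl⟩ := exists_perm_of_commute hW hV hlam hτ hρ.1
      (commute_of_mem_criticalPointsOn hρ₀ hθ hρ)
    exact ⟨π, rfl⟩
  · rintro _ ⟨π, rfl⟩
    exact mem_criticalPointsOn_cost_iff.2 ⟨diagonalIn_mem_unitaryOrbit hW hV lam π,
      fun v hv => cost_tangent_diagonalIn hW hlam π hv⟩

/-- The cost has exactly `n!` critical points on the orbit, which can be listed by increasing
cost. -/
theorem exists_monotone_enum_criticalPointsOn {ρ₀ θ : Matrix (Fin n) (Fin n) ℂ}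
    (hρ₀ : ρ₀.IsHermitian) (hθ : θ.IsHermitian)
    (hρ₀simple : Function.Injective hρ₀.eigenvalues)
    (hθsimple : Function.Injective hθ.eigenvalues) :
    ∃ ρc : Fin (Nat.factorial n) → Matrix (Fin n) (Fin n) ℂ,
      Function.Injective ρc ∧
      Set.range ρc = criticalPointsOn (cost θ) (unitaryOrbit ρ₀) ∧
      Monotone (fun i => cost θ (ρc i)) := by
  obtain ⟨V, hV, hρ₀V⟩ := exists_unitary_diagonalization hρ₀
  obtain ⟨W, hW, hθW⟩ := exists_unitary_diagonalization hθ
  have hrange : criticalPointsOn (cost θ) (unitaryOrbit ρ₀)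
      = Set.range (diagonalIn W hρ₀.eigenvalues) := by
    have := criticalPointsOn_cost_eq_range hW hV hρ₀simple hθsimple (hρ₀V ▸ hρ₀) (hθW ▸ hθ)
    rwa [← hρ₀V, ← hθW] at this
  let e : Fin (Nat.factorial n) ≃ Equiv.Perm (Fin n) :=
    (Fintype.equivFinOfCardEq (by rw [Fintype.card_perm, Fintype.card_fin])).symm
  let c : Fin (Nat.factorial n) → Matrix (Fin n) (Fin n) ℂ :=
    diagonalIn W hρ₀.eigenvalues ∘ e
  let σ := Tuple.sort (cost θ ∘ c)
  refine ⟨c ∘ σ, ((diagonalIn_injective hW hρ₀simple).comp e.injective).comp σ.injective, ?_,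
    Tuple.monotone_sort (cost θ ∘ c)⟩
  rw [hrange, EquivLike.range_comp, EquivLike.range_comp]

end Classification

end QuantumControl

theorem mainTheorem4 (n : ℕ) (T : ℝ) (hT : 0 < T)
    (H₀ H₁ ρ₀ θ : Matrix (Fin n) (Fin n) ℂ)
    (hH₀ : H₀ᴴ = -H₀) (hH₀tr : H₀.trace = 0)
    (hH₁ : H₁ᴴ = -H₁) (hH₁tr : H₁.trace = 0)
    (hρ₀ : ρ₀.IsHermitian) (hθ : θ.IsHermitian)
    (hρ₀simple : Function.Injective hρ₀.eigenvalues)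
    (hθsimple : Function.Injective hθ.eigenvalues)
    (hreg : ∀ u : Control T, IsRegularControl H₀ H₁ ρ₀ T u) :
    ((∀ u : Control T, ∃ ρ, IsTrajectory H₀ H₁ ρ₀ T u ρ) ∧
      (∀ (u : Control T) (ρ : ℝ → Matrix (Fin n) (Fin n) ℂ),
        IsTrajectory H₀ H₁ ρ₀ T u ρ → ρ T = endPoint H₀ H₁ ρ₀ T u) ∧
      (∀ u : Control T, endPoint H₀ H₁ ρ₀ T u ∈ unitaryOrbit ρ₀) ∧
      ContDiff ℝ ∞ (endPoint H₀ H₁ ρ₀ T)) ∧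
    ∃ ρc : Fin (Nat.factorial n) → Matrix (Fin n) (Fin n) ℂ,
      Function.Injective ρc ∧
      Set.range ρc = criticalPointsOn (cost θ) (unitaryOrbit ρ₀) ∧
      Monotone (fun i => cost θ (ρc i)) ∧
      criticalPoints (controlCost H₀ H₁ ρ₀ θ T) = ⋃ i, fibre H₀ H₁ ρ₀ T (ρc i) ∧
      Pairwise (fun i j => Disjoint (fibre H₀ H₁ ρ₀ T (ρc i)) (fibre H₀ H₁ ρ₀ T (ρc j))) ∧
      ∀ i, IsSubmanifoldOfCodim (orbitDim ρ₀) (fibre H₀ H₁ ρ₀ T (ρc i)) ∧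
        ∀ u ∈ fibre H₀ H₁ ρ₀ T (ρc i),
          tangentVectors (fibre H₀ H₁ ρ₀ T (ρc i)) u =
            {v : Control T | fderiv ℝ (endPoint H₀ H₁ ρ₀ T) u v = 0} := by
  obtain ⟨ρc, hinj, hrange, hmono⟩ :=
    exists_monotone_enum_criticalPointsOn hρ₀ hθ hρ₀simple hθsimple
  have hsmooth := contDiff_endPoint hT.le H₀ H₁ ρ₀
  refine ⟨⟨exists_isTrajectory hT.le ρ₀, fun u ρ h => h.apply_eq_endPoint hT.le,
    endPoint_mem_unitaryOrbit hT.le hH₀ hH₁ ρ₀, hsmooth⟩, ρc, hinj, hrange, hmono, ?_, ?_, ?_⟩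
  · rw [criticalPoints_controlCost hT.le hH₀ hH₁ hreg, ← hrange]
    ext u
    simp [fibre, eq_comm]
  · intro i j hij
    exact Set.disjoint_left.2 fun u hi hj => hij (hinj (hi.symm.trans hj))
  · refine fun i => ⟨isSubmanifoldOfCodim_fibre hsmooth hreg (ρc i), fun u hu => ?_⟩
    have hu' : endPoint H₀ H₁ ρ₀ T u = ρc i := hu
    rw [← hu']
    exact tangentVectors_fibre hsmooth hreg u
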